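/- Let $\frac{\varpi}{2}=\int_0^1\frac{dt}{\sqrt{1-t^4}}$. Let $\varphi:\mathbb{R}\to\mathbb{R}$ be the lemniscatic function: on $[-\frac{\varpi}{2},\frac{\varpi}{2}]$ it is the inverse function of $r\mapsto\int_0^r\frac{dt}{\sqrt{1-t^4}}$ on $[-1,1]$, and it is extended to $\mathbb{R}$ by $\varphi(s+\varpi)=-\varphi(s)$. It is extended to a meromorphic function on $\mathbb{C}$ by $$\varphi(x+iy)=\frac{\varphi(x)\varphi'(y)+i\,\varphi(y)\varphi'(x)}{1-\varphi(x)^2\varphi(y)^2}\qquad(x,y\in\mathbb{R}).$$ Let $\mathcal{O}=\mathbb{Z}[i]$. An element $\beta\in\mathcal{O}$ is called odd if it is relatively prime to $1+i$, and an odd $\gamma\in\mathcal{O}$ is called normalized if $\gamma\equiv 1 \bmod 2(1+i)$. For odd $\gamma\in\mathcal{O}$ put $\delta_\gamma=\frac{(1+i)\varpi}{\gamma}$ and define the $\gamma$-th lemnatomic polynomial $$\Lambda_\gamma(x)=\prod_{[\alpha]\in(\mathcal{O}/\gamma\mathcal{O})^\times}\bigl(x-\varphi(\alpha\delta_\gamma)\bigr).$$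 Let $\beta\in\mathcal{O}$ be odd. There is a unique monic polynomial $P_\beta\in\mathcal{O}[x]$ such that, for some $Q_\beta\in\mathcal{O}[x]$ relatively prime to $P_\beta$ and some $\varepsilon\in\{0,1,2,3\}$ with $\beta\equiv i^\varepsilon \bmod 2(1+i)$, $$\varphi(\beta z)=i^\varepsilon\varphi(z)\,\frac{P_\beta(\varphi(z)^4)}{Q_\beta(\varphi(z)^4)}$$ as meromorphic functions of $z\in\mathbb{C}$; the polynomial $xP_\beta(x^4)$ is called the $\beta$-division polynomial. It factors as $$xP_\beta(x^4)=\prod_{\gamma\mid\beta}\Lambda_\gamma(x),$$ where the product is over the finitely many normalized divisors $\gamma$ of $\beta$. -/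

import Mathlib

open Polynomial

noncomputable section

namespace Lemniscate

/-- The arc length `∫₀ʳ dt / √(1 - t⁴)` of the lemniscate as a function of the (signed) radial
distance `r ∈ [-1, 1]`. -/
def arcLength (r : ℝ) : ℝ := ∫ t in (0 : ℝ)..r, 1 / Real.sqrt (1 - t ^ 4)

/-- The lemniscate constant `ϖ`: half of it is the arc length of the first-quadrant portion. -/
def varpi : ℝ := 2 * arcLength 1

/-- The inverse function `[-ϖ/2, ϖ/2] → [-1, 1]` of the arc length. -/
def arcInv (s : ℝ) : ℝ := Function.invFunOn arcLength (Set.Icc (-1) 1) s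

/-- The real lemniscatic function `φ : ℝ → ℝ` of period `2ϖ`. It extends the inverse of the arc
length by the rule `φ (s + n ϖ) = (-1) ^ n φ s`; here `n` is the integer with
`-ϖ/2 ≤ s - n ϖ < ϖ/2`. -/
def phiReal (s : ℝ) : ℝ :=
  (-1) ^ ⌊s / varpi + 1 / 2⌋ * arcInv (s - (⌊s / varpi + 1 / 2⌋ : ℝ) * varpi)

/-- The denominator of `φ (x + i y)`, as a function of `z = x + i y`. -/
def phiDenom (z : ℂ) : ℝ := 1 - phiReal z.re ^ 2 * phiReal z.im ^ 2

/-- The complex lemniscatic function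
`φ (x + i y) = (φ x φ' y + i φ y φ' x) / (1 - (φ x)² (φ y)²)`.
At its poles the division by zero makes the value `0`, see `IsPole`. -/
def phi (z : ℂ) : ℂ :=
  ((phiReal z.re * deriv phiReal z.im : ℝ) + Complex.I * (phiReal z.im * deriv phiReal z.re : ℝ)) /
    (phiDenom z : ℂ)

/-- `z` is a pole of `φ`. The denominator vanishes exactly at the points
`(ϖ/2 + m ϖ) + i (ϖ/2 + n ϖ)` with integers `m, n`, and these are the poles of `φ`. -/
def IsPole (z : ℂ) : Prop := phiDenom z = 0

/-- The Gaussian integer `i`. -/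
def gI : GaussianInt := ⟨0, 1⟩

/-- A Gaussian integer is odd if it is relatively prime to `1 + i`. -/
def IsOdd (β : GaussianInt) : Prop := IsCoprime β (1 + gI)

/-- An odd Gaussian integer is normalized if it is congruent to `1` modulo `2 (1 + i)`. -/
def IsNormalized (β : GaussianInt) : Prop := IsOdd β ∧ 2 * (1 + gI) ∣ β - 1

/-- Evaluation at a complex number of a polynomial with Gaussian integer coefficients. -/
def evalC (P : GaussianInt[X]) (z : ℂ) : ℂ := P.eval₂ GaussianInt.toComplex z

/-- `P` is the polynomial `P_β` of the complex multiplication formula for `φ`: it is monic, and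
there are `Q` relatively prime to `P` in `ℤ[i][X]` and `ε ∈ {0, 1, 2, 3}` with
`β ≡ i ^ ε mod 2 (1 + i)` such that
`φ (β z) = i ^ ε φ(z) P(φ(z)⁴) / Q(φ(z)⁴)`
(an identity between meromorphic functions of `z`, stated where both `φ z` and `φ (β z)` are
finite; the denominator on the right does not vanish there). -/
def IsMulNumerator (β : GaussianInt) (P : GaussianInt[X]) : Prop :=
  P.Monic ∧ ∃ (Q : GaussianInt[X]) (ε : ℕ), IsRelPrime P Q ∧ ε < 4 ∧
    2 * (1 + gI) ∣ β - gI ^ ε ∧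
    ∀ z : ℂ, ¬ IsPole z → ¬ IsPole (GaussianInt.toComplex β * z) →
      evalC Q (phi z ^ 4) ≠ 0 ∧
      phi (GaussianInt.toComplex β * z) =
        Complex.I ^ ε * phi z * (evalC P (phi z ^ 4) / evalC Q (phi z ^ 4))

/-- The polynomial `x P(x⁴)`, with complex coefficients. For `P = P_β` this is the
`β`-division polynomial. -/
def divisionPoly (P : GaussianInt[X]) : ℂ[X] :=
  (X * P.comp (X ^ 4)).map GaussianInt.toComplex

/-- The `β`-torsion generator `δ_β = (1 + i) ϖ / β`. -/
def delta (β : GaussianInt) : ℂ := (1 + Complex.I) * (varpi : ℂ) / GaussianInt.toComplex β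

/-- A representative in `ℤ[i]` of a residue class modulo `β`. -/
def rep (β : GaussianInt) (a : GaussianInt ⧸ Ideal.span {β}) : GaussianInt :=
  Function.surjInv Ideal.Quotient.mk_surjective a

/-- The `β`-th lemnatomic polynomial: the product of `x - φ (α δ_β)` over the classes `[α]` in
`(ℤ[i] / β ℤ[i])ˣ`, a finite group for `β ≠ 0`. For odd `β` the value `φ (α δ_β)` does not depend
on the representative `α`. -/
def lemnatomic (β : GaussianInt) : ℂ[X] :=
  ∏ᶠ u : (GaussianInt ⧸ Ideal.span {β})ˣ,
    (X - C (phi (GaussianInt.toComplex (rep β u) * delta β)))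

end Lemniscate

end

namespace Lemniscate

open MeasureTheory Set Filter Topology

/-! ### The arc length -/

/-! Both sides are monic polynomials with simple roots, and both have the values of `φ` at the
points `α δ_β`, `α` modulo `β`, as their roots.

Analysis. On the real line `φ` satisfies `φ'² = 1 - φ⁴` and `φ'' = -2φ³` (`satisfiesODE`), which
gives Euler's addition theorem (`phiReal_add`). The same equations make the extension holomorphic
off its poles (`differentiableAt_phi`), and the identity theorem carries everything over to `ℂ`
(`phi_add`, `psi_add`). The poles form the coset of `ω = (1 + i) ϖ / 2` modulo `ϖ ℤ[i]`, and `φ(z +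
ω) φ(z) = -i` (`phi_add_omega_mul`).

Multiplication formula. Adding the addition formulas for `βz + ηz` and `βz - ηz` gives a recurrence
from `β - η` and `β` to `β + η`. For `η` associated to `1 + i` its coefficients are rational in
`φ(z)`, so starting from units it reaches every odd `β` (`IsOdd.hasLocalMul`). Translation by `ω`
reverses the coefficients of numerator and denominator. This makes the leading coefficient of the
reduced numerator a unit, so it can be taken monic (`IsOdd.exists_monic`). Uniqueness follows by
cross-multiplying two coprime representations.

Roots. Since `φ` is onto `ℂ` (`exists_phi_eq`), each root is a value `φ(z)`, and `φ(βz) = 0` makes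
it a torsion value (`IsMulNumerator.isRoot_iff`). Roots are simple because `φ'² = 1` at zeros of `φ`
(`IsMulNumerator.eval_derivative_ne_zero`). Torsion values with different `α` modulo `β` differ
(`IsOdd.dvd_sub_of_phi_delta_eq`). Writing `α / β` in lowest terms with normalized denominator `γ`
sorts the roots by `γ`, and the roots belonging to `γ` are those of `Λ_γ`. -/

theorem intervalIntegrable_arcLength_zero_one :
    IntervalIntegrable (fun t : ℝ => 1 / Real.sqrt (1 - t ^ 4)) volume 0 1 := by
  -- On `[0, 1]` one has `1 - t ≤ 1 - t⁴`, so `(1 - t)^(-1/2)` dominates the integrand.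
  have h1 : IntervalIntegrable (fun t : ℝ => (1 - t) ^ (-(1 / 2) : ℝ)) volume 0 1 := by
    have h := (intervalIntegral.intervalIntegrable_rpow' (a := 0) (b := 1)
      (r := (-(1 / 2) : ℝ)) (by norm_num)).comp_sub_left 1
    simpa using h.symm
  refine h1.mono_fun ?_ ?_
  · refine Measurable.aestronglyMeasurable ?_
    fun_prop
  · rw [Filter.EventuallyLE, ae_restrict_iff' measurableSet_uIoc]
    refine Filter.Eventually.of_forall fun t ht => ?_
    rw [uIoc_of_le zero_le_one] at ht
    obtain ⟨h0, h1⟩ := ht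
    have hle : 1 - t ≤ 1 - t ^ 4 := by
      have : t ^ 4 ≤ t := by
        calc t ^ 4 ≤ t ^ 1 := pow_le_pow_of_le_one h0.le h1 (by norm_num)
          _ = t := pow_one t
      linarith
    rw [Real.rpow_neg (by linarith), ← Real.sqrt_eq_rpow, Real.norm_of_nonneg (by positivity),
      Real.norm_of_nonneg (by positivity)]
    rcases h1.eq_or_lt with rfl | h1
    · simp
    · rw [one_div]
      have : 0 < √(1 - t) := Real.sqrt_pos.2 (by linarith)
      gcongr

theorem intervalIntegrable_arcLength {a b : ℝ} (ha : a ∈ Icc (-1 : ℝ) 1)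
    (hb : b ∈ Icc (-1 : ℝ) 1) :
    IntervalIntegrable (fun t : ℝ => 1 / Real.sqrt (1 - t ^ 4)) volume a b := by
  have h : IntervalIntegrable (fun t : ℝ => 1 / Real.sqrt (1 - t ^ 4)) volume (-1) 0 := by
    have := (IntervalIntegrable.iff_comp_neg).1 intervalIntegrable_arcLength_zero_one
    have e : (fun t : ℝ => 1 / Real.sqrt (1 - (-t) ^ 4)) = fun t => 1 / Real.sqrt (1 - t ^ 4) := by
      ext t; congr 3; ring
    simp only [e] at this
    simpa using this.symm
  refine (h.trans intervalIntegrable_arcLength_zero_one).mono_set ?_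
  rw [uIcc_of_le (by norm_num : (-1 : ℝ) ≤ 1)]
  exact uIcc_subset_Icc ha hb

theorem arcLength_zero : arcLength 0 = 0 := by simp [arcLength]

theorem arcLength_neg (r : ℝ) : arcLength (-r) = -arcLength r := by
  unfold arcLength
  have := intervalIntegral.integral_comp_neg (a := 0) (b := r)
    (fun t : ℝ => 1 / Real.sqrt (1 - t ^ 4))
  rw [neg_zero, intervalIntegral.integral_symm 0 (-r)] at this
  rw [← neg_eq_iff_eq_neg, ← this]
  congr 1
  ext t
  congr 3
  ring

theorem one_sub_pow_four_pos {t : ℝ} (ht : t ∈ Ioo (-1 : ℝ) 1) : 0 < 1 - t ^ 4 := by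
  have h : t ^ 2 < 1 := by nlinarith [ht.1, ht.2]
  nlinarith [sq_nonneg t]

theorem strictMonoOn_arcLength : StrictMonoOn arcLength (Icc (-1) 1) := by
  intro a ha b hb hab
  have h0 : (0 : ℝ) ∈ Icc (-1 : ℝ) 1 := by constructor <;> norm_num
  have h := intervalIntegral.integral_interval_sub_left (intervalIntegrable_arcLength h0 hb)
    (intervalIntegrable_arcLength h0 ha)
  have hpos := intervalIntegral.intervalIntegral_pos_of_pos_on
    (intervalIntegrable_arcLength ha hb) (fun t ht => by
      have : 0 < 1 - t ^ 4 := one_sub_pow_four_pos ⟨ha.1.trans_lt ht.1, ht.2.trans_le hb.2⟩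
      positivity) hab
  unfold arcLength
  linarith

theorem continuousOn_arcLength : ContinuousOn arcLength (Icc (-1) 1) := by
  have h := intervalIntegral.continuousOn_primitive_interval'
    (intervalIntegrable_arcLength (a := -1) (b := 1) (by simp) (by simp))
    (a := 0) (by rw [uIcc_of_le (by norm_num)]; constructor <;> norm_num)
  rwa [uIcc_of_le (by norm_num : (-1 : ℝ) ≤ 1)] at h

theorem hasDerivAt_arcLength {r : ℝ} (hr : r ∈ Ioo (-1 : ℝ) 1) :
    HasDerivAt arcLength (1 / Real.sqrt (1 - r ^ 4)) r := by
  refine intervalIntegral.integral_hasDerivAt_right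
    (intervalIntegrable_arcLength (by constructor <;> norm_num) (Ioo_subset_Icc_self hr)) ?_ ?_
  · refine (Measurable.stronglyMeasurable ?_).stronglyMeasurableAtFilter
    fun_prop
  · refine ContinuousAt.div (by fun_prop) (by fun_prop) ?_
    exact (Real.sqrt_pos.2 (one_sub_pow_four_pos hr)).ne'

theorem arcLength_one : arcLength 1 = varpi / 2 := by simp [varpi]

theorem arcLength_neg_one : arcLength (-1) = -(varpi / 2) := by
  rw [arcLength_neg, arcLength_one]

theorem varpi_pos : 0 < varpi := by
  have := strictMonoOn_arcLength (a := 0) (b := 1) (by constructor <;> norm_num) (by simp)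
    zero_lt_one
  rw [arcLength_zero, arcLength_one] at this
  linarith

theorem bijOn_arcLength : BijOn arcLength (Icc (-1) 1) (Icc (-(varpi / 2)) (varpi / 2)) := by
  refine ⟨fun r hr => ?_, strictMonoOn_arcLength.injOn, ?_⟩
  · rw [← arcLength_one, ← arcLength_neg]
    exact ⟨strictMonoOn_arcLength.monotoneOn (by simp) hr hr.1,
      strictMonoOn_arcLength.monotoneOn hr (by simp) hr.2⟩
  · rw [← arcLength_one, ← arcLength_neg]
    exact intermediate_value_Icc (by norm_num) continuousOn_arcLength

/-! ### The inverse of the arc length -/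

theorem arcInv_mem {s : ℝ} (hs : s ∈ Icc (-(varpi / 2)) (varpi / 2)) :
    arcInv s ∈ Icc (-1 : ℝ) 1 :=
  Function.invFunOn_mem (bijOn_arcLength.surjOn hs)

theorem arcLength_arcInv {s : ℝ} (hs : s ∈ Icc (-(varpi / 2)) (varpi / 2)) :
    arcLength (arcInv s) = s :=
  Function.invFunOn_eq (bijOn_arcLength.surjOn hs)

theorem arcInv_arcLength {r : ℝ} (hr : r ∈ Icc (-1 : ℝ) 1) : arcInv (arcLength r) = r :=
  strictMonoOn_arcLength.injOn (arcInv_mem (bijOn_arcLength.mapsTo hr)) hr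
    (arcLength_arcInv (bijOn_arcLength.mapsTo hr))

theorem arcInv_neg {s : ℝ} (hs : s ∈ Icc (-(varpi / 2)) (varpi / 2)) :
    arcInv (-s) = -arcInv s := by
  have h := arcInv_mem hs
  have h' : -arcInv s ∈ Icc (-1 : ℝ) 1 := ⟨by linarith [h.2], by linarith [h.1]⟩
  rw [← arcInv_arcLength h', arcLength_neg, arcLength_arcInv hs]

theorem continuousOn_arcInv : ContinuousOn arcInv (Icc (-(varpi / 2)) (varpi / 2)) := by
  rw [continuousOn_iff_continuous_domRestrict]
  -- A monotone surjection between these intervals is automatically continuous.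
  let g : Icc (-(varpi / 2)) (varpi / 2) → Icc (-1 : ℝ) 1 := fun s => ⟨arcInv s, arcInv_mem s.2⟩
  have hmono : Monotone g := fun s t hst => by
    refine (strictMonoOn_arcLength.le_iff_le (arcInv_mem s.2) (arcInv_mem t.2)).1 ?_
    rw [arcLength_arcInv s.2, arcLength_arcInv t.2]
    exact hst
  have hsurj : Function.Surjective g := fun r =>
    ⟨⟨arcLength r, bijOn_arcLength.mapsTo r.2⟩, Subtype.ext (arcInv_arcLength r.2)⟩
  exact continuous_subtype_val.comp (hmono.continuous_of_surjective hsurj)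

theorem arcInv_mem_Ioo {s : ℝ} (hs : s ∈ Ioo (-(varpi / 2)) (varpi / 2)) :
    arcInv s ∈ Ioo (-1 : ℝ) 1 := by
  have hs' := Ioo_subset_Icc_self hs
  have h := arcInv_mem hs'
  have h2 := arcLength_arcInv hs'
  refine ⟨h.1.lt_of_ne fun e => ?_, h.2.lt_of_ne fun e => ?_⟩
  · rw [← e, arcLength_neg_one] at h2
    linarith [hs.1]
  · rw [e, arcLength_one] at h2
    linarith [hs.2]

theorem hasDerivAt_arcInv {s : ℝ} (hs : s ∈ Ioo (-(varpi / 2)) (varpi / 2)) :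
    HasDerivAt arcInv (Real.sqrt (1 - arcInv s ^ 4)) s := by
  have h := arcInv_mem_Ioo hs
  have hpos := Real.sqrt_pos.2 (one_sub_pow_four_pos h)
  have := HasDerivAt.of_local_left_inverse (f := arcLength) (g := arcInv) (a := s)
    (f' := 1 / Real.sqrt (1 - arcInv s ^ 4))
    (continuousOn_arcInv.continuousAt (Icc_mem_nhds hs.1 hs.2))
    (hasDerivAt_arcLength h) (by positivity) ?_
  · simpa using this
  · filter_upwards [Icc_mem_nhds hs.1 hs.2] with y hy using arcLength_arcInv hy

/-! ### The real lemniscatic function -/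

theorem phiReal_add_int_mul_varpi (s : ℝ) (n : ℤ) :
    phiReal (s + n * varpi) = (-1) ^ n * phiReal s := by
  have h := varpi_pos.ne'
  have e : (s + n * varpi) / varpi + 1 / 2 = s / varpi + 1 / 2 + n := by field_simp; ring
  unfold phiReal
  rw [e, Int.floor_add_intCast, zpow_add₀ (by norm_num)]
  push_cast
  rw [show s + n * varpi - ((⌊s / varpi + 1 / 2⌋ : ℝ) + n) * varpi =
    s - (⌊s / varpi + 1 / 2⌋ : ℝ) * varpi by ring]
  ring

theorem phiReal_add_varpi (s : ℝ) : phiReal (s + varpi) = -phiReal s := by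
  simpa using phiReal_add_int_mul_varpi s 1

theorem phiReal_eq_arcInv_of_mem_Ico {s : ℝ} (hs : s ∈ Ico (-(varpi / 2)) (varpi / 2)) :
    phiReal s = arcInv s := by
  have hp := varpi_pos
  have e : ⌊s / varpi + 1 / 2⌋ = 0 := by
    rw [Int.floor_eq_zero_iff]
    have h1 : s = s / varpi * varpi := by field_simp
    rw [h1] at hs
    refine ⟨?_, ?_⟩ <;> nlinarith [hs.1, hs.2]
  simp only [phiReal, e]
  simp

theorem phiReal_eq_arcInv {s : ℝ} (hs : s ∈ Icc (-(varpi / 2)) (varpi / 2)) :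
    phiReal s = arcInv s := by
  have hp := varpi_pos
  rcases hs.2.eq_or_lt with rfl | h
  · have e : varpi / 2 = -(varpi / 2) + varpi := by ring
    have hm : varpi / 2 ∈ Icc (-(varpi / 2)) (varpi / 2) := hs
    nth_rw 1 [e]
    rw [phiReal_add_varpi, phiReal_eq_arcInv_of_mem_Ico ⟨le_rfl, by linarith⟩, arcInv_neg hm,
      neg_neg]
  · exact phiReal_eq_arcInv_of_mem_Ico ⟨hs.1, h⟩

theorem phiReal_eq_arcInv_sub {s : ℝ} (hs : s ∈ Icc (varpi / 2) (varpi / 2 + varpi)) :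
    phiReal s = arcInv (varpi - s) := by
  have hm : s - varpi ∈ Icc (-(varpi / 2)) (varpi / 2) :=
    ⟨by linarith [hs.1], by linarith [hs.2]⟩
  have := phiReal_add_varpi (s - varpi)
  rw [sub_add_cancel] at this
  rw [this, phiReal_eq_arcInv hm, ← arcInv_neg hm, neg_sub]

/-- Every real number is, up to a multiple of `ϖ`, in `(-ϖ/2, ϖ/2]`. -/
theorem exists_add_int_mul_varpi (s : ℝ) :
    ∃ (t : ℝ) (n : ℤ), t ∈ Ioc (-(varpi / 2)) (varpi / 2) ∧ s = t + n * varpi := by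
  obtain ⟨n, hn, -⟩ := existsUnique_sub_zsmul_mem_Ioc varpi_pos s (-(varpi / 2))
  refine ⟨s - n • varpi, n, ⟨hn.1, by linarith [hn.2]⟩, by simp⟩

theorem abs_phiReal_le_one (s : ℝ) : |phiReal s| ≤ 1 := by
  obtain ⟨t, n, ht, rfl⟩ := exists_add_int_mul_varpi s
  rw [phiReal_add_int_mul_varpi, abs_mul, abs_zpow, phiReal_eq_arcInv (Ioc_subset_Icc_self ht)]
  simpa [abs_le] using arcInv_mem (Ioc_subset_Icc_self ht)

/-- Modulo `ϖ`, this is the only point where two branches of the definition meet: `arcInv s` on the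
left, `arcInv (ϖ - s)` on the right. -/
theorem continuousAt_phiReal_varpi_half : ContinuousAt phiReal (varpi / 2) := by
  have hp := varpi_pos
  rw [continuousAt_iff_continuous_left_right]
  constructor
  · have h : ContinuousWithinAt phiReal (Icc (-(varpi / 2)) (varpi / 2)) (varpi / 2) :=
      (continuousOn_arcInv _ ⟨by linarith, le_rfl⟩).congr (fun s hs => phiReal_eq_arcInv hs)
        (phiReal_eq_arcInv ⟨by linarith, le_rfl⟩)
    exact h.mono_of_mem_nhdsWithin (Icc_mem_nhdsLE (by linarith))
  · have h : ContinuousOn (fun s => arcInv (varpi - s)) (Icc (varpi / 2) (varpi / 2 + varpi)) :=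
      continuousOn_arcInv.comp (by fun_prop) fun s hs =>
        ⟨by linarith [hs.2], by linarith [hs.1]⟩
    have h' : ContinuousWithinAt phiReal (Icc (varpi / 2) (varpi / 2 + varpi)) (varpi / 2) :=
      (h _ ⟨le_rfl, by linarith⟩).congr (fun s hs => phiReal_eq_arcInv_sub hs)
        (phiReal_eq_arcInv_sub ⟨le_rfl, by linarith⟩)
    exact h'.mono_of_mem_nhdsWithin (Icc_mem_nhdsGE (by linarith))

theorem phiReal_neg (s : ℝ) : phiReal (-s) = -phiReal s := by
  obtain ⟨t, n, ht, rfl⟩ := exists_add_int_mul_varpi s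
  have h1 : -(t + n * varpi) = -t + (-n : ℤ) * varpi := by push_cast; ring
  have h2 : -t ∈ Icc (-(varpi / 2)) (varpi / 2) := ⟨by linarith [ht.2], by linarith [ht.1]⟩
  rw [h1, phiReal_add_int_mul_varpi, phiReal_add_int_mul_varpi,
    phiReal_eq_arcInv (Ioc_subset_Icc_self ht), phiReal_eq_arcInv h2,
    arcInv_neg (Ioc_subset_Icc_self ht), zpow_neg, ← inv_zpow]
  norm_num

theorem phiReal_zero : phiReal 0 = 0 := by
  have := phiReal_neg 0
  rw [neg_zero] at this
  linarith

theorem phiReal_varpi_half : phiReal (varpi / 2) = 1 := by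
  have hp := varpi_pos
  rw [phiReal_eq_arcInv ⟨by linarith, le_rfl⟩, ← arcLength_one, arcInv_arcLength (by simp)]

theorem hasDerivAt_phiReal_of_mem_Ioo {s : ℝ} (hs : s ∈ Ioo (-(varpi / 2)) (varpi / 2)) :
    HasDerivAt phiReal (Real.sqrt (1 - phiReal s ^ 4)) s := by
  rw [phiReal_eq_arcInv (Ioo_subset_Icc_self hs)]
  refine (hasDerivAt_arcInv hs).congr_of_eventuallyEq ?_
  filter_upwards [Icc_mem_nhds hs.1 hs.2] with y hy using phiReal_eq_arcInv hy

theorem phiReal_mem_Ioo {s : ℝ} (hs : s ∈ Ioo (-(varpi / 2)) (varpi / 2)) :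
    phiReal s ∈ Ioo (-1 : ℝ) 1 := by
  rw [phiReal_eq_arcInv (Ioo_subset_Icc_self hs)]
  exact arcInv_mem_Ioo hs

theorem deriv_phiReal_add_varpi (s : ℝ) : deriv phiReal (s + varpi) = -deriv phiReal s := by
  rw [← deriv_comp_add_const, ← deriv.fun_neg]
  congr 1
  ext y
  exact phiReal_add_varpi y

/-- A function that is continuous at `x` and whose derivative near `x` tends to `e` has derivative
`e` at `x`. -/
theorem hasDerivAt_of_tendsto_deriv {f : ℝ → ℝ} {x e : ℝ} (hf : ContinuousAt f x)
    (hd : ∀ᶠ y in 𝓝[≠] x, DifferentiableAt ℝ f y) (hlim : Tendsto (deriv f) (𝓝[≠] x) (𝓝 e)) :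
    HasDerivAt f e x := by
  have hR : {y | DifferentiableAt ℝ f y} ∈ 𝓝[>] x :=
    nhdsWithin_mono x (fun y hy => ne_of_gt hy) hd
  have hL : {y | DifferentiableAt ℝ f y} ∈ 𝓝[<] x :=
    nhdsWithin_mono x (fun y hy => ne_of_lt hy) hd
  have A := hasDerivWithinAt_Ici_of_tendsto_deriv
    (fun y hy => DifferentiableAt.differentiableWithinAt hy) hf.continuousWithinAt hR
    (hlim.mono_left (nhdsWithin_mono x fun y hy => ne_of_gt hy))
  have B := hasDerivWithinAt_Iic_of_tendsto_deriv
    (fun y hy => DifferentiableAt.differentiableWithinAt hy) hf.continuousWithinAt hL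
    (hlim.mono_left (nhdsWithin_mono x fun y hy => ne_of_lt hy))
  simpa using B.union A

/-- The differential equations of the lemniscatic function at the point `s`. -/
def SatisfiesODE (s : ℝ) : Prop :=
  DifferentiableAt ℝ phiReal s ∧ deriv phiReal s ^ 2 = 1 - phiReal s ^ 4 ∧
    HasDerivAt (deriv phiReal) (-2 * phiReal s ^ 3) s

theorem satisfiesODE_add_varpi {s : ℝ} : SatisfiesODE (s + varpi) ↔ SatisfiesODE s := by
  have h1 : (fun y => phiReal (y + varpi)) = fun y => -phiReal y := funext phiReal_add_varpi
  have h2 : (fun y => deriv phiReal (y + varpi)) = fun y => -deriv phiReal y :=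
    funext deriv_phiReal_add_varpi
  have h3 : DifferentiableAt ℝ phiReal (s + varpi) ↔ DifferentiableAt ℝ phiReal s := by
    rw [← differentiableAt_comp_add_const, h1]
    exact differentiableAt_fun_neg_iff
  have h4 : HasDerivAt (deriv phiReal) (-2 * phiReal (s + varpi) ^ 3) (s + varpi) ↔
      HasDerivAt (deriv phiReal) (-2 * phiReal s ^ 3) s := by
    constructor
    · intro h
      have := (h.comp_add_const s varpi)
      rw [h2] at this
      simpa [phiReal_add_varpi, Odd.neg_pow (by decide : Odd 3)] using this.fun_neg
    · intro h
      have h6 : HasDerivAt (fun y => deriv phiReal (y + varpi)) (2 * phiReal s ^ 3) s := by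
        rw [h2]
        simpa using h.fun_neg
      have := HasDerivAt.comp_sub_const (s + varpi) varpi (by rwa [add_sub_cancel_right])
      simpa [phiReal_add_varpi, Odd.neg_pow (by decide : Odd 3)] using this
  rw [SatisfiesODE, SatisfiesODE, h3, h4, phiReal_add_varpi, deriv_phiReal_add_varpi]
  norm_num

theorem satisfiesODE_of_mem_Ioo {s : ℝ} (hs : s ∈ Ioo (-(varpi / 2)) (varpi / 2)) :
    SatisfiesODE s := by
  have hd := hasDerivAt_phiReal_of_mem_Ioo hs
  have hpos := one_sub_pow_four_pos (phiReal_mem_Ioo hs)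
  refine ⟨hd.differentiableAt, ?_, ?_⟩
  · rw [hd.deriv, Real.sq_sqrt hpos.le]
  · have h : HasDerivAt (fun y => Real.sqrt (1 - phiReal y ^ 4)) (-2 * phiReal s ^ 3) s := by
      refine HasDerivAt.congr_deriv (((hd.pow 4).const_sub 1).sqrt hpos.ne') ?_
      have := (Real.sqrt_pos.2 hpos).ne'
      simp only [Pi.pow_apply]
      push_cast
      field_simp
      norm_num [mul_comm]
    refine h.congr_of_eventuallyEq ?_
    filter_upwards [Ioo_mem_nhds hs.1 hs.2] with y hy
      using (hasDerivAt_phiReal_of_mem_Ioo hy).deriv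

/-- The integrand of the arc length is singular at `r = 1`, so the inverse function rule does not
apply. Both derivatives are obtained instead as limits of derivatives at nearby points. -/
theorem satisfiesODE_varpi_half : SatisfiesODE (varpi / 2) := by
  have hp := varpi_pos
  have hc := continuousAt_phiReal_varpi_half
  have hev : ∀ᶠ y in 𝓝[≠] (varpi / 2), SatisfiesODE y := by
    filter_upwards [self_mem_nhdsWithin, nhdsWithin_le_nhds
      (Ioo_mem_nhds (a := -(varpi / 2)) (b := varpi / 2 + varpi) (x := varpi / 2) (by linarith)
        (by linarith))] with y hy hy'
    rcases lt_or_gt_of_ne hy with h | h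
    · exact satisfiesODE_of_mem_Ioo ⟨hy'.1, h⟩
    · rw [← sub_add_cancel y varpi, satisfiesODE_add_varpi]
      exact satisfiesODE_of_mem_Ioo ⟨by linarith, by linarith [hy'.2]⟩
  -- The equation controls only `|φ'| = √(1 - φ⁴)`; this suffices because the limit is `0`.
  have hlim : Tendsto (deriv phiReal) (𝓝[≠] (varpi / 2)) (𝓝 0) := by
    have h1 : Tendsto (fun y => Real.sqrt (1 - phiReal y ^ 4)) (𝓝[≠] (varpi / 2)) (𝓝 0) := by
      have : ContinuousAt (fun y => Real.sqrt (1 - phiReal y ^ 4)) (varpi / 2) := by fun_prop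
      simpa [ContinuousAt, phiReal_varpi_half] using this.tendsto.mono_left nhdsWithin_le_nhds
    rw [tendsto_zero_iff_abs_tendsto_zero]
    refine h1.congr' ?_
    filter_upwards [hev] with y hy
    rw [← hy.2.1, Real.sqrt_sq_eq_abs]
    rfl
  have hd := hasDerivAt_of_tendsto_deriv hc (hev.mono fun y hy => hy.1) hlim
  refine ⟨hd.differentiableAt, by rw [hd.deriv, phiReal_varpi_half]; norm_num, ?_⟩
  refine hasDerivAt_of_tendsto_deriv ?_ (hev.mono fun y hy => hy.2.2.differentiableAt) ?_
  · rw [continuousAt_iff_punctured_nhds, hd.deriv]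
    exact hlim
  · have : ContinuousAt (fun y => -2 * phiReal y ^ 3) (varpi / 2) := by fun_prop
    refine (this.tendsto.mono_left nhdsWithin_le_nhds).congr' ?_
    filter_upwards [hev] with y hy using hy.2.2.deriv.symm

theorem satisfiesODE (s : ℝ) : SatisfiesODE s := by
  obtain ⟨n, hn, -⟩ := existsUnique_sub_zsmul_mem_Ioc varpi_pos s (-(varpi / 2))
  have h0 : ∀ t ∈ Ioc (-(varpi / 2)) (varpi / 2), SatisfiesODE t := fun t ht => by
    rcases ht.2.eq_or_lt with rfl | h
    · exact satisfiesODE_varpi_half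
    · exact satisfiesODE_of_mem_Ioo ⟨ht.1, h⟩
  have hp : Function.Periodic SatisfiesODE varpi := fun t => propext satisfiesODE_add_varpi
  have := h0 _ ⟨hn.1, by linarith [hn.2]⟩
  rwa [hp.sub_zsmul_eq] at this

theorem hasDerivAt_phiReal (s : ℝ) : HasDerivAt phiReal (deriv phiReal s) s :=
  (satisfiesODE s).1.hasDerivAt

theorem deriv_phiReal_sq (s : ℝ) : deriv phiReal s ^ 2 = 1 - phiReal s ^ 4 := (satisfiesODE s).2.1

theorem hasDerivAt_deriv_phiReal (s : ℝ) : HasDerivAt (deriv phiReal) (-2 * phiReal s ^ 3) s :=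
  (satisfiesODE s).2.2

theorem deriv_phiReal_neg (s : ℝ) : deriv phiReal (-s) = deriv phiReal s := by
  have h := deriv_comp_neg phiReal s
  have e : (fun x => phiReal (-x)) = fun x => -phiReal x := funext phiReal_neg
  rw [e, deriv.fun_neg, neg_inj] at h
  exact h.symm

theorem deriv_phiReal_zero : deriv phiReal 0 = 1 := by
  have hp := varpi_pos
  have := (hasDerivAt_phiReal_of_mem_Ioo (s := 0) ⟨by linarith, by linarith⟩).deriv
  simpa [phiReal_zero] using this

theorem deriv_phiReal_nonneg {s : ℝ} (hs : s ∈ Icc (-(varpi / 2)) (varpi / 2)) :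
    0 ≤ deriv phiReal s := by
  by_cases h : s ∈ Ioo (-(varpi / 2)) (varpi / 2)
  · rw [(hasDerivAt_phiReal_of_mem_Ioo h).deriv]
    positivity
  · have h1 : phiReal s ^ 4 = 1 := by
      have : s = varpi / 2 ∨ s = -(varpi / 2) := by
        by_contra! hne
        exact h ⟨hs.1.lt_of_ne hne.2.symm, hs.2.lt_of_ne hne.1⟩
      rcases this with rfl | rfl
      · simp [phiReal_varpi_half]
      · norm_num [phiReal_neg, phiReal_varpi_half]
    have h2 := deriv_phiReal_sq s
    rw [h1, sub_self, sq_eq_zero_iff] at h2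
    exact h2.ge

theorem exists_phiReal_eq {r : ℝ} (hr : r ∈ Icc (-1 : ℝ) 1) :
    ∃ s ∈ Icc (-(varpi / 2)) (varpi / 2), phiReal s = r :=
  ⟨arcLength r, bijOn_arcLength.mapsTo hr, by
    rw [phiReal_eq_arcInv (bijOn_arcLength.mapsTo hr), arcInv_arcLength hr]⟩

theorem phiReal_eq_zero_iff {s : ℝ} : phiReal s = 0 ↔ ∃ n : ℤ, s = n * varpi := by
  constructor
  · intro h
    obtain ⟨t, n, ht, rfl⟩ := exists_add_int_mul_varpi s
    rw [phiReal_add_int_mul_varpi, phiReal_eq_arcInv (Ioc_subset_Icc_self ht)] at h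
    have h' : arcInv t = 0 := (mul_eq_zero.1 h).resolve_left (zpow_ne_zero _ (by norm_num))
    have := arcLength_arcInv (Ioc_subset_Icc_self ht)
    rw [h', arcLength_zero] at this
    exact ⟨n, by rw [← this, zero_add]⟩
  · rintro ⟨n, rfl⟩
    have := phiReal_add_int_mul_varpi 0 n
    rwa [zero_add, phiReal_zero, mul_zero] at this

theorem phiReal_sq_eq_one_iff {s : ℝ} :
    phiReal s ^ 2 = 1 ↔ ∃ n : ℤ, s = varpi / 2 + n * varpi := by
  have hp := varpi_pos
  constructor
  · intro h
    obtain ⟨t, n, ht, rfl⟩ := exists_add_int_mul_varpi s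
    rcases ht.2.eq_or_lt with rfl | h'
    · exact ⟨n, rfl⟩
    · have h1 := phiReal_mem_Ioo ⟨ht.1, h'⟩
      have h2 : phiReal (t + n * varpi) ^ 2 = phiReal t ^ 2 := by
        rw [phiReal_add_int_mul_varpi, mul_pow, ← zpow_natCast, ← zpow_mul, mul_comm n, zpow_mul]
        simp
      rw [h2] at h
      nlinarith [h1.1, h1.2]
  · rintro ⟨n, rfl⟩
    rw [phiReal_add_int_mul_varpi, phiReal_varpi_half, mul_one, ← zpow_natCast, ← zpow_mul,
      mul_comm n, zpow_mul]
    simp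

/-- Euler's addition theorem for the real lemniscatic function. -/
theorem phiReal_add (s t : ℝ) :
    phiReal (s + t) * (1 + phiReal s ^ 2 * phiReal t ^ 2) =
      phiReal s * deriv phiReal t + phiReal t * deriv phiReal s := by
  -- The addition formula evaluated at `s + τ` and `t - τ`, whose sum is fixed. The differential
  -- equations make `G` constant, and the claim compares `τ = 0` with `τ = t`.
  let G : ℝ → ℝ := fun τ =>
    (phiReal (s + τ) * deriv phiReal (t - τ) + phiReal (t - τ) * deriv phiReal (s + τ)) /
      (1 + phiReal (s + τ) ^ 2 * phiReal (t - τ) ^ 2)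
  have hG : ∀ τ, HasDerivAt G 0 τ := fun τ => by
    have ha := (hasDerivAt_phiReal (s + τ)).comp_const_add s τ
    have ha' := (hasDerivAt_deriv_phiReal (s + τ)).comp_const_add s τ
    have hb := (hasDerivAt_phiReal (t - τ)).comp_const_sub t τ
    have hb' := (hasDerivAt_deriv_phiReal (t - τ)).comp_const_sub t τ
    have h1 := deriv_phiReal_sq (s + τ)
    have h2 := deriv_phiReal_sq (t - τ)
    have hne : 1 + phiReal (s + τ) ^ 2 * phiReal (t - τ) ^ 2 ≠ 0 := by positivity
    refine HasDerivAt.congr_deriv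
      (((ha.mul hb').add (hb.mul ha')).div (((ha.pow 2).mul (hb.pow 2)).const_add 1) hne) ?_
    simp only [Pi.mul_apply, Pi.add_apply, Pi.pow_apply]
    rw [div_eq_zero_iff]
    left
    push_cast
    generalize phiReal (s + τ) = a at *
    generalize phiReal (t - τ) = b at *
    generalize deriv phiReal (s + τ) = a' at *
    generalize deriv phiReal (t - τ) = b' at *
    linear_combination (exp := 1) (-2 * a * b ^ 3) * h1 + (2 * a ^ 3 * b) * h2
  have hc := is_const_of_deriv_eq_zero (fun τ => (hG τ).differentiableAt) (fun τ => (hG τ).deriv) 0 t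
  have hne : 1 + phiReal s ^ 2 * phiReal t ^ 2 ≠ 0 := by positivity
  simp only [G, add_zero, sub_zero, sub_self, phiReal_zero, deriv_phiReal_zero] at hc
  rw [div_eq_iff hne] at hc
  rw [hc]
  ring

/-! ### Poles, zeros, periods and symmetries of the complex function. -/

theorem phiReal_sq_le_one (s : ℝ) : phiReal s ^ 2 ≤ 1 := by
  rw [sq_le_one_iff_abs_le_one]
  exact abs_phiReal_le_one s

theorem isPole_iff_sq {z : ℂ} : IsPole z ↔ phiReal z.re ^ 2 = 1 ∧ phiReal z.im ^ 2 = 1 := by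
  have h1 := phiReal_sq_le_one z.re
  have h2 := phiReal_sq_le_one z.im
  rw [IsPole, phiDenom]
  constructor
  · intro h
    constructor <;> nlinarith [sq_nonneg (phiReal z.re), sq_nonneg (phiReal z.im)]
  · rintro ⟨h3, h4⟩
    rw [h3, h4]
    norm_num

/-- The pole `(1 + i) ϖ / 2` of `φ`. -/
noncomputable def omega : ℂ := (1 + Complex.I) * varpi / 2

theorem add_lattice_re (z : ℂ) (γ : GaussianInt) :
    (z + varpi * GaussianInt.toComplex γ).re = z.re + γ.re * varpi := by
  rw [Complex.add_re, Complex.re_ofReal_mul, ← GaussianInt.intCast_re, mul_comm]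

theorem add_lattice_im (z : ℂ) (γ : GaussianInt) :
    (z + varpi * GaussianInt.toComplex γ).im = z.im + γ.im * varpi := by
  rw [Complex.add_im, Complex.im_ofReal_mul, ← GaussianInt.intCast_im, mul_comm]

theorem omega_re : omega.re = varpi / 2 := by simp [omega]

theorem omega_im : omega.im = varpi / 2 := by simp [omega]

theorem isPole_iff {z : ℂ} :
    IsPole z ↔ ∃ γ : GaussianInt, z = omega + varpi * GaussianInt.toComplex γ := by
  rw [isPole_iff_sq, phiReal_sq_eq_one_iff, phiReal_sq_eq_one_iff]
  constructor
  · rintro ⟨⟨m, hm⟩, ⟨n, hn⟩⟩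
    refine ⟨⟨m, n⟩, ?_⟩
    apply Complex.ext
    · rw [add_lattice_re, hm, omega_re]
    · rw [add_lattice_im, hn, omega_im]
  · rintro ⟨γ, rfl⟩
    exact ⟨⟨γ.re, by rw [add_lattice_re, omega_re]⟩, ⟨γ.im, by rw [add_lattice_im, omega_im]⟩⟩

/-- The numerator vanishes iff `φ(x) φ'(y) = 0 = φ(y) φ'(x)`. On the real line `φ` and `φ'` have no
common zero, and `φ'(x) = φ'(y) = 0` would make `z` a pole. -/
theorem phi_eq_zero_iff {z : ℂ} (hz : ¬ IsPole z) :
    phi z = 0 ↔ ∃ γ : GaussianInt, z = varpi * GaussianInt.toComplex γ := by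
  have hD : (phiDenom z : ℂ) ≠ 0 := by exact_mod_cast hz
  have h1 := deriv_phiReal_sq z.re
  have h2 := deriv_phiReal_sq z.im
  have key : phi z = 0 ↔ phiReal z.re = 0 ∧ phiReal z.im = 0 := by
    rw [phi, div_eq_zero_iff, or_iff_left hD, Complex.ext_iff]
    simp only [Complex.add_re, Complex.ofReal_re, Complex.mul_re, Complex.I_re, zero_mul,
      Complex.I_im, Complex.ofReal_im, mul_zero, sub_zero, add_zero, Complex.zero_re,
      Complex.add_im, Complex.mul_im, one_mul, zero_add, Complex.zero_im, mul_eq_zero]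
    rw [isPole_iff_sq] at hz
    constructor
    · rintro ⟨h3 | h3, h4 | h4⟩
      · exact ⟨h3, h4⟩
      · rw [h3, h4] at h1
        norm_num at h1
      · rw [h3, h4] at h2
        norm_num at h2
      · rw [h4] at h1
        rw [h3] at h2
        refine absurd ⟨?_, ?_⟩ hz <;> nlinarith [sq_nonneg (phiReal z.re), sq_nonneg (phiReal z.im)]
    · rintro ⟨h3, h4⟩
      exact ⟨Or.inl h3, Or.inl h4⟩
  rw [key, phiReal_eq_zero_iff, phiReal_eq_zero_iff]
  constructor
  · rintro ⟨⟨m, hm⟩, ⟨n, hn⟩⟩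
    refine ⟨⟨m, n⟩, ?_⟩
    apply Complex.ext
    · rw [← zero_add (_ * _), add_lattice_re, hm, Complex.zero_re, zero_add]
    · rw [← zero_add (_ * _), add_lattice_im, hn, Complex.zero_im, zero_add]
  · rintro ⟨γ, rfl⟩
    rw [← zero_add (_ * _), add_lattice_re, add_lattice_im]
    exact ⟨⟨γ.re, zero_add _⟩, ⟨γ.im, zero_add _⟩⟩

theorem isPole_add_lattice {z : ℂ} (γ : GaussianInt) :
    IsPole (z + varpi * GaussianInt.toComplex γ) ↔ IsPole z := by
  rw [isPole_iff, isPole_iff]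
  constructor
  · rintro ⟨δ, h⟩
    exact ⟨δ - γ, by rw [map_sub]; linear_combination h⟩
  · rintro ⟨δ, h⟩
    exact ⟨δ + γ, by rw [map_add]; linear_combination h⟩

theorem countable_isPole : {z | IsPole z}.Countable := by
  have : {z | IsPole z} ⊆ range (fun p : ℤ × ℤ =>
      omega + varpi * GaussianInt.toComplex ⟨p.1, p.2⟩) := by
    intro z hz
    obtain ⟨γ, rfl⟩ := isPole_iff.1 hz
    exact ⟨(γ.re, γ.im), rfl⟩
  exact (countable_range _).mono this

theorem continuous_phiReal : Continuous phiReal :=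
  continuous_iff_continuousAt.2 fun s => (hasDerivAt_phiReal s).continuousAt

theorem continuous_phiDenom : Continuous phiDenom := by
  have := continuous_phiReal
  unfold phiDenom
  fun_prop

theorem isClosed_isPole : IsClosed {z | IsPole z} :=
  isClosed_singleton.preimage continuous_phiDenom

theorem eventually_not_isPole {z : ℂ} (hz : ¬ IsPole z) : ∀ᶠ w in 𝓝 z, ¬ IsPole w :=
  isClosed_isPole.isOpen_compl.mem_nhds hz

theorem phi_ofReal (x : ℝ) : phi x = phiReal x := by
  simp [phi, phiDenom, phiReal_zero, deriv_phiReal_zero]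

theorem not_isPole_ofReal (x : ℝ) : ¬ IsPole x := by
  simp [IsPole, phiDenom, phiReal_zero]

theorem not_isPole_zero : ¬ IsPole 0 := by
  simpa using not_isPole_ofReal 0

theorem phi_zero : phi 0 = 0 := by
  simpa [phiReal_zero] using phi_ofReal 0

theorem isPole_neg {z : ℂ} : IsPole (-z) ↔ IsPole z := by
  simp [IsPole, phiDenom, phiReal_neg]

theorem isPole_I_mul {z : ℂ} : IsPole (Complex.I * z) ↔ IsPole z := by
  simp [IsPole, phiDenom, phiReal_neg, mul_comm]

theorem phi_neg (z : ℂ) : phi (-z) = -phi z := by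
  simp only [phi, phiDenom, Complex.neg_re, Complex.neg_im, phiReal_neg, deriv_phiReal_neg, neg_sq]
  push_cast
  ring

theorem phi_I_mul (z : ℂ) : phi (Complex.I * z) = Complex.I * phi z := by
  have h1 : (Complex.I * z).re = -z.im := by simp
  have h2 : (Complex.I * z).im = z.re := by simp
  simp only [phi, phiDenom, h1, h2, phiReal_neg, deriv_phiReal_neg, neg_sq]
  push_cast
  rw [mul_comm ((phiReal z.im : ℂ) ^ 2)]
  ring_nf
  rw [Complex.I_sq]
  ring

theorem phi_add_lattice (z : ℂ) (γ : GaussianInt) :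
    phi (z + varpi * GaussianInt.toComplex γ) = (-1) ^ (γ.re + γ.im) * phi z := by
  have hd : ∀ (s : ℝ) (n : ℤ), deriv phiReal (s + n * varpi) = (-1) ^ n * deriv phiReal s := by
    intro s n
    rw [← deriv_comp_add_const, ← deriv_const_mul_field]
    congr 1
    ext y
    exact phiReal_add_int_mul_varpi y n
  have hs : ∀ n : ℤ, (((-1 : ℝ) ^ n) ^ 2) = 1 := fun n => by
    rw [← zpow_natCast, ← zpow_mul, mul_comm n, zpow_mul]
    simp
  simp only [phi, phiDenom, add_lattice_re, add_lattice_im, phiReal_add_int_mul_varpi, hd, mul_pow,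
    hs, one_mul]
  rw [zpow_add₀ (by norm_num)]
  push_cast
  ring

/-! ### Complex differentiability -/

theorem hasFDerivAt_ofReal_comp_re {F : ℝ → ℝ} {F' : ℝ} {z : ℂ} (h : HasDerivAt F F' z.re) :
    HasFDerivAt (fun w : ℂ => (F w.re : ℂ)) (Complex.reCLM.smulRight (F' : ℂ)) z := by
  refine (Complex.ofRealCLM.hasFDerivAt.comp z
    (h.comp_hasFDerivAt z Complex.reCLM.hasFDerivAt)).congr_fderiv ?_
  ext
  simp [mul_comm]

theorem hasFDerivAt_ofReal_comp_im {F : ℝ → ℝ} {F' : ℝ} {z : ℂ} (h : HasDerivAt F F' z.im) :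
    HasFDerivAt (fun w : ℂ => (F w.im : ℂ)) (Complex.imCLM.smulRight (F' : ℂ)) z := by
  refine (Complex.ofRealCLM.hasFDerivAt.comp z
    (h.comp_hasFDerivAt z Complex.imCLM.hasFDerivAt)).congr_fderiv ?_
  ext
  simp [mul_comm]

/-- Real differentiability is visible from the formula; the Cauchy–Riemann equation reduces to `φ'²
= 1 - φ⁴` at `x` and at `y`. -/
theorem differentiableAt_phi {z : ℂ} (hz : ¬ IsPole z) : DifferentiableAt ℂ phi z := by
  have ha := hasFDerivAt_ofReal_comp_re (hasDerivAt_phiReal z.re)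
  have ha' := hasFDerivAt_ofReal_comp_re (hasDerivAt_deriv_phiReal z.re)
  have hb := hasFDerivAt_ofReal_comp_im (hasDerivAt_phiReal z.im)
  have hb' := hasFDerivAt_ofReal_comp_im (hasDerivAt_deriv_phiReal z.im)
  have h1 : ((deriv phiReal z.re : ℝ) : ℂ) ^ 2 = 1 - (phiReal z.re : ℂ) ^ 4 := by
    exact_mod_cast deriv_phiReal_sq z.re
  have h2 : ((deriv phiReal z.im : ℝ) : ℂ) ^ 2 = 1 - (phiReal z.im : ℂ) ^ 4 := by
    exact_mod_cast deriv_phiReal_sq z.im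
  have hD : 1 - (phiReal z.re : ℂ) ^ 2 * (phiReal z.im : ℂ) ^ 2 ≠ 0 := by
    have : (phiDenom z : ℂ) ≠ 0 := by exact_mod_cast hz
    simpa [phiDenom] using this
  have hN := (ha.mul hb').add ((hb.mul ha').const_mul Complex.I)
  have hE := ((ha.pow 2).mul (hb.pow 2)).const_sub (1 : ℂ)
  have hF := hN.mul ((hasDerivAt_inv hD).comp_hasFDerivAt z hE)
  have hphi := hF.congr_of_eventuallyEq (f₁ := phi) (Filter.Eventually.of_forall fun w => by
    simp [phi, phiDenom, div_eq_mul_inv])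
  rw [differentiableAt_complex_iff_differentiableAt_real]
  refine ⟨hphi.differentiableAt, ?_⟩
  rw [hphi.fderiv]
  simp
  field_simp
  generalize (phiReal z.re : ℂ) = a at *
  generalize (phiReal z.im : ℂ) = b at *
  generalize ((deriv phiReal z.re : ℝ) : ℂ) = a' at *
  generalize ((deriv phiReal z.im : ℝ) : ℂ) = b' at *
  linear_combination (2 * a ^ 3 * b) * h2 + (2 * a * b ^ 3) * h1 -
    (2 * a * b ^ 3 * a' ^ 2 - 2 * a ^ 3 * b * (1 - a ^ 2 * b ^ 2)) * Complex.I_sq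

/-- Two functions that are holomorphic off a countable closed set and agree on the real line
agree. -/
theorem eqOn_of_eqOn_real {s : Set ℂ} (hs : s.Countable) (hcl : IsClosed s) {f g : ℂ → ℂ}
    (hf : ∀ z, z ∉ s → DifferentiableAt ℂ f z) (hg : ∀ z, z ∉ s → DifferentiableAt ℂ g z)
    (h : ∀ x : ℝ, (x : ℂ) ∉ s → f x = g x) {z : ℂ} (hz : z ∉ s) : f z = g z := by
  -- Removing a countable set does not disconnect the plane, so the identity theorem applies.
  have hconn : IsPreconnected sᶜ :=
    (hs.isConnected_compl_of_one_lt_rank (by rw [Complex.rank_real_complex]; norm_num)).isPreconnected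
  have hf' : AnalyticOnNhd ℂ f sᶜ :=
    DifferentiableOn.analyticOnNhd (fun w hw => (hf w hw).differentiableWithinAt) hcl.isOpen_compl
  have hg' : AnalyticOnNhd ℂ g sᶜ :=
    DifferentiableOn.analyticOnNhd (fun w hw => (hg w hw).differentiableWithinAt) hcl.isOpen_compl
  obtain ⟨x, hx⟩ : ∃ x : ℝ, (x : ℂ) ∉ s :=
    ((hs.preimage Complex.ofReal_injective).dense_compl ℝ).nonempty
  refine hf'.eqOn_of_preconnected_of_frequently_eq hg' hconn hx ?_ hz
  have ht : Tendsto (fun y : ℝ => (y : ℂ)) (𝓝[≠] x) (𝓝[≠] (x : ℂ)) :=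
    Complex.continuous_ofReal.continuousAt.continuousWithinAt.tendsto_nhdsWithin
      fun y hy => by simpa using hy
  refine ht.frequently (Eventually.frequently ?_)
  have : ∀ᶠ y : ℝ in 𝓝[≠] x, (y : ℂ) ∉ s := nhdsWithin_le_nhds
    (Complex.continuous_ofReal.continuousAt.preimage_mem_nhds (hcl.isOpen_compl.mem_nhds hx))
  filter_upwards [this] with y hy using h y hy

/-- The derivative of `φ`. -/
noncomputable def psi : ℂ → ℂ := deriv phi

theorem hasDerivAt_phi {z : ℂ} (hz : ¬ IsPole z) : HasDerivAt phi (psi z) z :=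
  (differentiableAt_phi hz).hasDerivAt

theorem differentiableAt_psi {z : ℂ} (hz : ¬ IsPole z) : DifferentiableAt ℂ psi z := by
  have h : AnalyticOnNhd ℂ phi {z | IsPole z}ᶜ :=
    DifferentiableOn.analyticOnNhd (fun w hw => (differentiableAt_phi hw).differentiableWithinAt)
      isClosed_isPole.isOpen_compl
  exact (h.deriv z hz).differentiableAt

theorem deriv_ofReal_of_eq {f : ℂ → ℂ} {F : ℝ → ℝ} {f' : ℂ} {F' x : ℝ} (h : ∀ y : ℝ, f y = F y)
    (hf : HasDerivAt f f' x) (hF : HasDerivAt F F' x) : f' = F' := by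
  have h1 := hf.comp_ofReal
  have h2 := hF.ofReal_comp
  simp only [h] at h1
  exact h1.unique h2

theorem psi_ofReal (x : ℝ) : psi x = (deriv phiReal x : ℝ) :=
  deriv_ofReal_of_eq phi_ofReal (hasDerivAt_phi (not_isPole_ofReal x)) (hasDerivAt_phiReal x)

theorem psi_zero : psi 0 = 1 := by
  simpa [deriv_phiReal_zero] using psi_ofReal 0

theorem psi_sq {z : ℂ} (hz : ¬ IsPole z) : psi z ^ 2 = 1 - phi z ^ 4 :=
  eqOn_of_eqOn_real (f := fun z => psi z ^ 2) (g := fun z => 1 - phi z ^ 4)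
    countable_isPole isClosed_isPole
    (fun _ hw => (differentiableAt_psi hw).pow 2)
    (fun _ hw => ((differentiableAt_phi hw).pow 4).const_sub 1)
    (fun x _ => by
      simp only [psi_ofReal, phi_ofReal]
      exact_mod_cast deriv_phiReal_sq x) hz

theorem hasDerivAt_psi {z : ℂ} (hz : ¬ IsPole z) : HasDerivAt psi (-2 * phi z ^ 3) z := by
  have hd : ∀ w ∉ {w | IsPole w}, DifferentiableAt ℂ (deriv psi) w := fun w hw => by
    have h : AnalyticOnNhd ℂ psi {z | IsPole z}ᶜ :=
      DifferentiableOn.analyticOnNhd (fun w hw => (differentiableAt_psi hw).differentiableWithinAt)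
        isClosed_isPole.isOpen_compl
    exact (h.deriv w hw).differentiableAt
  have := eqOn_of_eqOn_real (f := deriv psi) (g := fun z => -2 * phi z ^ 3)
    countable_isPole isClosed_isPole hd
    (fun _ hw => ((differentiableAt_phi hw).pow 3).const_mul (-2))
    (fun x hx => by
      have := deriv_ofReal_of_eq psi_ofReal (differentiableAt_psi hx).hasDerivAt
        (hasDerivAt_deriv_phiReal x)
      rw [this, phi_ofReal]
      push_cast
      ring) hz
  rw [← this]
  exact (differentiableAt_psi hz).hasDerivAt

/-! ### Addition theorems on `ℂ` and translation by `ω`. -/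

theorem countable_isPole_add (v : ℂ) : {u | IsPole u ∨ IsPole (u + v)}.Countable :=
  countable_isPole.union (countable_isPole.preimage (add_left_injective v))

theorem isClosed_isPole_add (v : ℂ) : IsClosed {u | IsPole u ∨ IsPole (u + v)} :=
  isClosed_isPole.union (isClosed_isPole.preimage (continuous_add_const v))

/-- The addition theorem for the lemniscatic function. -/
theorem phi_add {u v : ℂ} (hu : ¬ IsPole u) (hv : ¬ IsPole v) (huv : ¬ IsPole (u + v)) :
    phi (u + v) * (1 + phi u ^ 2 * phi v ^ 2) = phi u * psi v + phi v * psi u := by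
  -- The identity theorem is used once per variable: first in `u` with `v` real, then in `v` with
  -- `u` complex.
  have hreal : ∀ (u : ℂ) (v : ℝ), ¬ IsPole u → ¬ IsPole (u + v) →
      phi (u + v) * (1 + phi u ^ 2 * phi v ^ 2) = phi u * psi v + phi v * psi u := by
    intro u v hu huv
    refine eqOn_of_eqOn_real
      (f := fun u => phi (u + v) * (1 + phi u ^ 2 * phi v ^ 2))
      (g := fun u => phi u * psi v + phi v * psi u)
      (countable_isPole_add v) (isClosed_isPole_add v) ?_ ?_ ?_ (not_or.2 ⟨hu, huv⟩)
    · intro w hw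
      have h1 := differentiableAt_phi (not_or.1 hw).1
      have h2 := differentiableAt_comp_add_const.2 (differentiableAt_phi (not_or.1 hw).2)
      fun_prop
    · intro w hw
      have h1 := differentiableAt_phi (not_or.1 hw).1
      have h2 := differentiableAt_psi (not_or.1 hw).1
      fun_prop
    · intro x _
      simp only [← Complex.ofReal_add, psi_ofReal, phi_ofReal]
      exact_mod_cast phiReal_add x v
  refine eqOn_of_eqOn_real
    (f := fun v => phi (u + v) * (1 + phi u ^ 2 * phi v ^ 2))
    (g := fun v => phi u * psi v + phi v * psi u)
    (countable_isPole_add u) (isClosed_isPole_add u) ?_ ?_ ?_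
    (not_or.2 ⟨hv, by rwa [add_comm]⟩)
  · intro w hw
    have h1 := differentiableAt_phi (not_or.1 hw).1
    have h2 := differentiableAt_comp_add_const.2 (differentiableAt_phi (not_or.1 hw).2)
    simp only [add_comm _ u] at h2
    fun_prop
  · intro w hw
    have h1 := differentiableAt_phi (not_or.1 hw).1
    have h2 := differentiableAt_psi (not_or.1 hw).1
    fun_prop
  · intro x hx
    exact hreal u x hu (by rw [add_comm]; exact (not_or.1 hx).2)

/-- This is the derivative of `phi_add` with respect to `u`, cleared of denominators. -/
theorem psi_add {u v : ℂ} (hu : ¬ IsPole u) (hv : ¬ IsPole v) (huv : ¬ IsPole (u + v)) :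
    psi (u + v) * (1 + phi u ^ 2 * phi v ^ 2) ^ 2 =
      psi u * psi v * (1 - phi u ^ 2 * phi v ^ 2) -
        2 * phi u * phi v * (phi u ^ 2 + phi v ^ 2) := by
  have h1 := hasDerivAt_phi hu
  have h2 := (hasDerivAt_phi huv).comp_add_const u v
  have h3 := hasDerivAt_psi hu
  have hL := h2.mul (((h1.pow 2).mul_const (phi v ^ 2)).const_add 1)
  have hR := (h1.mul_const (psi v)).add (h3.const_mul (phi v))
  have hev : (fun w => phi w * psi v + phi v * psi w) =ᶠ[𝓝 u]
      (fun w => phi (w + v) * (1 + phi w ^ 2 * phi v ^ 2)) := by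
    filter_upwards [eventually_not_isPole hu,
      (continuous_add_const v).continuousAt.eventually (eventually_not_isPole huv)] with w hw hw'
    exact (phi_add hw hv hw').symm
  have key := (hL.congr_of_eventuallyEq hev).unique hR
  have ha := phi_add hu hv huv
  have hs := psi_sq hu
  simp only [Pi.pow_apply] at key
  push_cast at key
  linear_combination (1 + phi u ^ 2 * phi v ^ 2) * key -
    (2 * phi u * psi u * phi v ^ 2) * ha - 2 * phi u * phi v ^ 3 * hs

theorem psi_neg (z : ℂ) : psi (-z) = psi z := by
  have h := deriv_comp_neg phi z
  have e : (fun x => phi (-x)) = fun x => -phi x := funext phi_neg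
  rw [e, deriv.fun_neg, neg_inj] at h
  exact h.symm

theorem psi_I_mul {z : ℂ} (hz : ¬ IsPole z) : psi (Complex.I * z) = psi z := by
  have h1 : HasDerivAt (fun w => phi (Complex.I * w)) (psi (Complex.I * z) * (Complex.I * 1)) z :=
    HasDerivAt.comp z (hasDerivAt_phi (by rwa [isPole_I_mul])) ((hasDerivAt_id z).const_mul _)
  have h2 := (hasDerivAt_phi hz).const_mul Complex.I
  simp only [phi_I_mul] at h1
  have := h1.unique h2
  have hI := Complex.I_ne_zero
  apply mul_left_cancel₀ hI
  linear_combination this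

/-- `φ ((1 + i) z)` in terms of `φ z` and `φ' z`. -/
theorem phi_one_add_I_mul {z : ℂ} (hz : ¬ IsPole z) (hz' : ¬ IsPole ((1 + Complex.I) * z)) :
    phi ((1 + Complex.I) * z) * (1 - phi z ^ 4) = (1 + Complex.I) * phi z * psi z := by
  have e : (1 + Complex.I) * z = z + Complex.I * z := by ring
  rw [e] at hz' ⊢
  have := phi_add hz (by rwa [isPole_I_mul]) hz'
  rw [phi_I_mul, psi_I_mul hz] at this
  linear_combination this - phi (z + Complex.I * z) * phi z ^ 4 * Complex.I_sq

theorem psi_one_add_I_mul {z : ℂ} (hz : ¬ IsPole z) (hz' : ¬ IsPole ((1 + Complex.I) * z)) :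
    psi ((1 + Complex.I) * z) * (1 - phi z ^ 4) ^ 2 = (1 + phi z ^ 4) * (1 - phi z ^ 4) := by
  have e : (1 + Complex.I) * z = z + Complex.I * z := by ring
  rw [e] at hz' ⊢
  have := psi_add hz (by rwa [isPole_I_mul]) hz'
  rw [phi_I_mul, psi_I_mul hz] at this
  have hs := psi_sq hz
  have h1 : (Complex.I * phi z) ^ 2 = - phi z ^ 2 := by rw [mul_pow, Complex.I_sq]; ring
  rw [h1] at this
  linear_combination this + (1 + phi z ^ 4) * hs

theorem isPole_add_omega {z : ℂ} : IsPole (z + omega) ↔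
    ∃ γ : GaussianInt, z = varpi * GaussianInt.toComplex γ := by
  rw [isPole_iff]
  refine exists_congr fun γ => ?_
  rw [add_comm z, add_left_cancel_iff]

/-- Translation by the pole `ω` inverts the lemniscatic function. -/
theorem phi_add_omega_mul {z : ℂ} (hz : ¬ IsPole z) (hz' : ¬ IsPole (z + omega)) :
    phi (z + omega) * phi z = -Complex.I := by
  refine eqOn_of_eqOn_real (f := fun z => phi (z + omega) * phi z) (g := fun _ => -Complex.I)
    (countable_isPole_add omega) (isClosed_isPole_add omega) ?_ (fun _ _ => by fun_prop) ?_
    (not_or.2 ⟨hz, hz'⟩)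
  · intro w hw
    have h1 := differentiableAt_phi (not_or.1 hw).1
    have h2 := differentiableAt_comp_add_const.2 (differentiableAt_phi (not_or.1 hw).2)
    fun_prop
  · intro x hx
    have hp := (not_or.1 hx).2
    have hd : deriv phiReal (varpi / 2) = 0 := by
      have := deriv_phiReal_sq (varpi / 2)
      rwa [phiReal_varpi_half, one_pow, sub_self, sq_eq_zero_iff] at this
    have h1 : ((x : ℂ) + omega).re = x + varpi / 2 := by simp [omega_re]
    have h2 : ((x : ℂ) + omega).im = varpi / 2 := by simp [omega_im]
    -- Since `φ'(ϖ/2) = 0`, subtracting `ϖ/2` leaves a single term: `φ(x) (1 + c²) = -c'` with `c =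
    -- φ(x + ϖ/2)` and `c' = φ'(x + ϖ/2)`.
    have hadd := phiReal_add (x + varpi / 2) (-(varpi / 2))
    rw [add_neg_cancel_right, phiReal_neg, deriv_phiReal_neg, hd, phiReal_varpi_half] at hadd
    have hs := deriv_phiReal_sq (x + varpi / 2)
    rw [IsPole, phiDenom, h1, h2, phiReal_varpi_half] at hp

    rw [phi_ofReal]
    simp only [phi, phiDenom, h1, h2, phiReal_varpi_half, hd]
    generalize phiReal (x + varpi / 2) = c at *
    generalize deriv phiReal (x + varpi / 2) = c' at *
    generalize phiReal x = a at *
    have hp' : (1 - (c : ℂ) ^ 2) ≠ 0 := by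
      have : ((1 - c ^ 2 * 1 ^ 2 : ℝ) : ℂ) ≠ 0 := by exact_mod_cast hp
      simpa using this
    have key : c' * a = -(1 - c ^ 2) := by
      have h : (1 + c ^ 2) ≠ 0 := by positivity
      apply mul_right_cancel₀ h
      linear_combination c' * hadd - hs
    have key' : (c' : ℂ) * a = -(1 - c ^ 2) := by exact_mod_cast key
    push_cast
    simp only [one_pow, mul_one, mul_zero, one_mul, zero_add]
    rw [div_mul_eq_mul_div, div_eq_iff hp']
    linear_combination Complex.I * key'

/-! ### Surjectivity -/

theorem eq_of_sq_eq_of_mul_nonneg {u v : ℝ} (h : u ^ 2 = v ^ 2) (h' : 0 ≤ u * v) : u = v := by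
  rcases sq_eq_sq_iff_eq_or_eq_neg.1 h with h | h
  · exact h
  · subst h
    have : v ^ 2 ≤ 0 := by linarith
    have : v = 0 := by nlinarith
    simp [this]

theorem exists_sq_eq_mul_nonneg {s : ℝ} (hs : 0 ≤ s) (t : ℝ) : ∃ a : ℝ, a ^ 2 = s ∧ 0 ≤ a * t := by
  rcases le_total 0 t with h | h
  · exact ⟨√s, Real.sq_sqrt hs, by positivity⟩
  · refine ⟨-√s, by rw [neg_sq, Real.sq_sqrt hs], ?_⟩
    have := Real.sqrt_nonneg s
    nlinarith

/-- The squares of `φ x` and `φ y` for a point `x + i y` with given value of `φ` in the unit disc,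
in terms of the squares `X` and `Y` of the real and imaginary part of this value. -/
theorem exists_sq_coordinates {X Y : ℝ} (hX : 0 ≤ X) (hY : 0 ≤ Y) (hXY : X + Y ≤ 1) :
    ∃ s r : ℝ, 0 ≤ s ∧ s ≤ 1 ∧ 0 ≤ r ∧ r ≤ 1 ∧ s * r < 1 ∧
      s * (1 - r ^ 2) = X * (1 - s * r) ^ 2 ∧ r * (1 - s ^ 2) = Y * (1 - s * r) ^ 2 := by
  -- Put `p = s r`. The sum and difference of the two equations become `s + r = (X + Y)(1 - p)` and
  -- `(s - r)(1 + p) = (X - Y)(1 - p)²`. Then `g p = 0` is the identity `(s - r)² = (s + r)² - 4p`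
  -- times `(1 + p)²`, and `g 0 = 4XY`, `g 1 = -16`.
  let g : ℝ → ℝ := fun p =>
    ((X + Y) ^ 2 * (1 - p) ^ 2 - 4 * p) * (1 + p) ^ 2 - (X - Y) ^ 2 * (1 - p) ^ 4
  have hg : ContinuousOn g (Icc 0 1) := by fun_prop
  obtain ⟨p, ⟨hp0, hp1⟩, hp⟩ : (0 : ℝ) ∈ g '' Icc 0 1 := by
    refine intermediate_value_Icc' zero_le_one hg ⟨?_, ?_⟩
    · norm_num [g]
    · have : 0 ≤ X * Y := mul_nonneg hX hY
      simp only [g]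
      nlinarith
  have hp1' : p < 1 := by
    refine hp1.lt_of_ne fun h => ?_
    rw [h] at hp
    norm_num [g] at hp
  have hq : 1 + p ≠ 0 := by linarith
  set σ := (X + Y) * (1 - p) with hσ
  set δ := (X - Y) * (1 - p) ^ 2 / (1 + p) with hδ
  have hδ1 : δ * (1 + p) = (X - Y) * (1 - p) ^ 2 := by rw [hδ]; field_simp
  have hδ2 : δ ^ 2 = σ ^ 2 - 4 * p := by
    have : (δ ^ 2 - (σ ^ 2 - 4 * p)) * (1 + p) ^ 2 = 0 := by
      simp only [g] at hp
      rw [hσ]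
      linear_combination (δ * (1 + p) + (X - Y) * (1 - p) ^ 2) * hδ1 - hp
    have := (mul_eq_zero.1 this).resolve_right (pow_ne_zero 2 hq)
    linarith
  have hσ0 : 0 ≤ σ := mul_nonneg (by linarith) (by linarith)
  have hσ1 : σ ≤ 1 := by nlinarith
  have hsr : (σ + δ) / 2 * ((σ - δ) / 2) = p := by linear_combination -hδ2 / 4
  have habs : |δ| ≤ σ := abs_le_of_sq_le_sq (by linarith) hσ0
  obtain ⟨h1, h2⟩ := abs_le.1 habs
  refine ⟨(σ + δ) / 2, (σ - δ) / 2, by linarith, by linarith, by linarith, by linarith,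
    by rw [hsr]; exact hp1', ?_, ?_⟩
  · rw [hsr]
    linear_combination (1 - p) / 2 * hσ + hδ1 / 2 - (σ - δ) / 2 * hsr
  · rw [hsr]
    linear_combination (1 - p) / 2 * hσ - hδ1 / 2 - (σ + δ) / 2 * hsr

/-- The squares of `φ(x)` and `φ(y)` come from `exists_sq_coordinates`, their signs from those of
`w.re` and `w.im`. Choosing `x, y` in `[-ϖ/2, ϖ/2]` makes `φ'` nonnegative there, so agreement of
squares gives agreement of values. -/
theorem exists_phi_eq_of_norm_le_one {w : ℂ} (hw : ‖w‖ ≤ 1) : ∃ z, ¬ IsPole z ∧ phi z = w := by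
  have hn : w.re ^ 2 + w.im ^ 2 ≤ 1 := by
    have h := Complex.sq_norm w
    rw [Complex.normSq_apply] at h
    nlinarith [norm_nonneg w]
  obtain ⟨s, r, hs0, hs1, hr0, hr1, hsr, hX, hY⟩ :=
    exists_sq_coordinates (sq_nonneg w.re) (sq_nonneg w.im) hn
  obtain ⟨a, has, haw⟩ := exists_sq_eq_mul_nonneg hs0 w.re
  obtain ⟨b, hbr, hbw⟩ := exists_sq_eq_mul_nonneg hr0 w.im
  have ha : a ∈ Icc (-1 : ℝ) 1 := by
    rw [mem_Icc, ← abs_le, ← sq_le_one_iff_abs_le_one, has]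
    exact hs1
  have hb : b ∈ Icc (-1 : ℝ) 1 := by
    rw [mem_Icc, ← abs_le, ← sq_le_one_iff_abs_le_one, hbr]
    exact hr1
  obtain ⟨x, hx, rfl⟩ := exists_phiReal_eq ha
  obtain ⟨y, hy, rfl⟩ := exists_phiReal_eq hb
  have hx' := deriv_phiReal_nonneg hx
  have hy' := deriv_phiReal_nonneg hy
  have hx2 := deriv_phiReal_sq x
  have hy2 := deriv_phiReal_sq y
  have hD : phiDenom ⟨x, y⟩ = 1 - s * r := by simp [phiDenom, has, hbr]
  have hpos : 0 < 1 - s * r := by linarith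
  refine ⟨⟨x, y⟩, ?_, ?_⟩
  · rw [IsPole, hD]
    exact hpos.ne'
  · have h1 : phiReal x * deriv phiReal y = w.re * (1 - s * r) := by
      refine eq_of_sq_eq_of_mul_nonneg ?_ ?_
      · rw [mul_pow, mul_pow, ← hX, hy2, ← has, ← hbr]
        ring
      · have := mul_nonneg (mul_nonneg haw hy') hpos.le
        linarith
    have h2 : phiReal y * deriv phiReal x = w.im * (1 - s * r) := by
      refine eq_of_sq_eq_of_mul_nonneg ?_ ?_
      · rw [mul_pow, mul_pow, ← hY, hx2, ← has, ← hbr]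
        ring
      · have := mul_nonneg (mul_nonneg hbw hx') hpos.le
        linarith
    have hne : ((1 - s * r : ℝ) : ℂ) ≠ 0 := by exact_mod_cast hpos.ne'
    rw [phi, hD, div_eq_iff hne]
    simp only [h1, h2]
    nth_rw 3 [← Complex.re_add_im w]
    push_cast
    ring

/-- Outside the unit disc, translation by `ω` reduces to `-i / w`, which lies inside. -/
theorem exists_phi_eq (w : ℂ) : ∃ z, ¬ IsPole z ∧ phi z = w := by
  rcases le_or_gt ‖w‖ 1 with hw | hw
  · exact exists_phi_eq_of_norm_le_one hw
  · have hw0 : w ≠ 0 := by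
      rintro rfl
      norm_num at hw
    obtain ⟨z, hz, h⟩ := exists_phi_eq_of_norm_le_one (w := -Complex.I / w) (by
      rw [norm_div, norm_neg, Complex.norm_I]
      exact (div_le_one (by linarith)).2 hw.le)
    have hne : phi z ≠ 0 := by
      rw [h]
      exact div_ne_zero (neg_ne_zero.2 Complex.I_ne_zero) hw0
    have hz' : ¬ IsPole (z + omega) := by
      rw [isPole_add_omega, ← phi_eq_zero_iff hz]
      exact hne
    refine ⟨z + omega, hz', ?_⟩
    have := phi_add_omega_mul hz hz'
    rw [h] at this hne
    apply mul_right_cancel₀ hne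
    rw [this]
    field_simp

/-! ### Fibres -/

/-- The numerators in the addition theorem for `z - w` and `z + w` multiply to `φ(z)² ψ(w)² - φ(w)²
ψ(z)²`, which vanishes because `ψ²` is a function of `φ`. -/
theorem phi_sub_or_phi_add_eq_zero {z w : ℂ} (hz : ¬ IsPole z) (hw : ¬ IsPole w)
    (hsub : ¬ IsPole (z - w)) (hadd : ¬ IsPole (z + w)) (hzz : ¬ IsPole (z + z))
    (h : phi z = phi w) : phi (z - w) = 0 ∨ phi (z + w) = 0 := by
  have hs := psi_sq hz
  have hs' := psi_sq hw
  have h1 := phi_add hz hz hzz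
  have h2 := phi_add hz hw hadd
  have h3 := phi_add hz (by rwa [isPole_neg]) (by rwa [← sub_eq_add_neg] : ¬ IsPole (z + -w))
  rw [← sub_eq_add_neg, phi_neg, psi_neg] at h3
  rw [← h] at hs' h2 h3
  -- Here finiteness of `φ(2z)` enters: a vanishing denominator in the duplication formula would
  -- force `φ(z) ψ(z) = 0`, against `ψ² = 1 - φ⁴ = 2`.
  have hne : 1 + phi z ^ 4 ≠ 0 := fun h0 => by
    have h4 : phi z * psi z = 0 := by linear_combination -h1 / 2 + phi (z + z) * h0 / 2
    rcases mul_eq_zero.1 h4 with h5 | h5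
    · rw [h5] at h0
      norm_num at h0
    · rw [h5] at hs
      have : (2 : ℂ) = 0 := by linear_combination h0 - hs
      norm_num at this
  have hprod : phi (z - w) * phi (z + w) * (1 + phi z ^ 4) ^ 2 = 0 := by
    linear_combination (phi (z + w) * (1 + phi z ^ 4)) * h3 +
      (phi z * psi w - phi z * psi z) * h2 + phi z ^ 2 * (hs' - hs)
  exact mul_eq_zero.1 ((mul_eq_zero.1 hprod).resolve_right (pow_ne_zero 2 hne))

/-! ### Odd Gaussian integers -/

theorem toComplex_gI : GaussianInt.toComplex gI = Complex.I := by
  simp [gI, GaussianInt.toComplex_def']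

theorem one_add_gI_dvd_iff {γ : GaussianInt} : 1 + gI ∣ γ ↔ Even (γ.re + γ.im) := by
  constructor
  · rintro ⟨δ, rfl⟩
    refine ⟨δ.re, ?_⟩
    simp [gI]
  · rintro ⟨a, ha⟩
    refine ⟨⟨a, a - γ.re⟩, ?_⟩
    rw [Zsqrtd.ext_iff]
    simp [gI]
    omega

theorem not_isUnit_one_add_gI : ¬ IsUnit (1 + gI) := fun h => by
  have := one_add_gI_dvd_iff.1 (h.dvd (a := (1 : GaussianInt)))
  simp at this

theorem isOdd_iff_odd {β : GaussianInt} : IsOdd β ↔ Odd (β.re + β.im) := by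
  constructor
  · intro h
    rw [← Int.not_even_iff_odd, ← one_add_gI_dvd_iff]
    intro hd
    exact not_isUnit_one_add_gI (h.isUnit_of_dvd' hd dvd_rfl)
  · intro h
    have : 1 + gI ∣ β - 1 := by
      rw [one_add_gI_dvd_iff]
      have e : (β - 1).re + (β - 1).im = β.re + β.im - 1 := by simp; ring
      rw [e]
      exact h.sub_odd odd_one
    obtain ⟨κ, hκ⟩ := this
    exact ⟨1, -κ, by linear_combination hκ⟩

theorem IsOdd.exists_eq {β : GaussianInt} (h : IsOdd β) : ∃ κ, β = 1 + (1 + gI) * κ := by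
  have : 1 + gI ∣ β - 1 := by
    rw [one_add_gI_dvd_iff]
    have e : (β - 1).re + (β - 1).im = β.re + β.im - 1 := by simp; ring
    rw [e]
    exact (isOdd_iff_odd.1 h).sub_odd odd_one
  obtain ⟨κ, hκ⟩ := this
  exact ⟨κ, by linear_combination hκ⟩

theorem IsOdd.ne_zero {β : GaussianInt} (h : IsOdd β) : β ≠ 0 := by
  rintro rfl
  have := isOdd_iff_odd.1 h
  simp at this

theorem toComplex_ne_zero {β : GaussianInt} (h : β ≠ 0) : GaussianInt.toComplex β ≠ 0 := by
  rwa [Ne, GaussianInt.toComplex_eq_zero]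

theorem IsOdd.of_dvd {β γ : GaussianInt} (h : IsOdd β) (hd : γ ∣ β) : IsOdd γ :=
  IsCoprime.of_isCoprime_of_dvd_left h hd

theorem varpi_ne_zero : (varpi : ℂ) ≠ 0 := by exact_mod_cast varpi_pos.ne'

theorem gI_sq : gI ^ 2 = -1 := by decide

/-- Multiplication by an odd Gaussian integer fixes the pole `ω` modulo `ϖ ℤ[i]`. -/
theorem IsOdd.mul_omega {β : GaussianInt} (h : IsOdd β) :
    ∃ κ : GaussianInt, GaussianInt.toComplex β * omega = omega + varpi * GaussianInt.toComplex κ := by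
  obtain ⟨κ, rfl⟩ := h.exists_eq
  -- `(1 + i) ω = i ϖ`, as `(1 + i)² = 2i`.
  refine ⟨gI * κ, ?_⟩
  simp only [map_add, map_mul, map_one, toComplex_gI, omega]
  linear_combination (GaussianInt.toComplex κ * varpi / 2) * Complex.I_sq

theorem not_isPole_lattice (γ : GaussianInt) : ¬ IsPole (varpi * GaussianInt.toComplex γ) := by
  rw [← zero_add (_ * _), isPole_add_lattice]
  exact not_isPole_zero

theorem phi_lattice (γ : GaussianInt) : phi (varpi * GaussianInt.toComplex γ) = 0 :=
  (phi_eq_zero_iff (not_isPole_lattice γ)).2 ⟨γ, rfl⟩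

/-- Points whose product with an odd `β` lies in `ϖ ℤ[i]` are not poles. -/
theorem IsOdd.not_isPole {β : GaussianInt} (h : IsOdd β) {z : ℂ} {γ : GaussianInt}
    (hz : GaussianInt.toComplex β * z = varpi * GaussianInt.toComplex γ) : ¬ IsPole z := by
  rw [isPole_iff]
  rintro ⟨δ, rfl⟩
  obtain ⟨κ, hκ⟩ := h.mul_omega
  refine not_isPole_lattice γ (isPole_iff.2 ⟨κ + β * δ, ?_⟩)
  rw [← hz, mul_add, hκ, map_add, map_mul]
  ring

/-! ### Evaluation of polynomials at values of `φ` -/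

theorem evalC_add (P Q : GaussianInt[X]) (z : ℂ) : evalC (P + Q) z = evalC P z + evalC Q z :=
  eval₂_add _ _

theorem evalC_sub (P Q : GaussianInt[X]) (z : ℂ) : evalC (P - Q) z = evalC P z - evalC Q z :=
  eval₂_sub _

theorem evalC_mul (P Q : GaussianInt[X]) (z : ℂ) : evalC (P * Q) z = evalC P z * evalC Q z :=
  eval₂_mul _ _

theorem evalC_pow (P : GaussianInt[X]) (n : ℕ) (z : ℂ) : evalC (P ^ n) z = evalC P z ^ n :=
  eval₂_pow _ _ _

theorem evalC_C (c : GaussianInt) (z : ℂ) : evalC (C c) z = GaussianInt.toComplex c :=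
  eval₂_C _ _

theorem evalC_X (z : ℂ) : evalC X z = z := eval₂_X _ _

theorem evalC_one (z : ℂ) : evalC 1 z = 1 := eval₂_one _ _

theorem evalC_eq_eval_map (P : GaussianInt[X]) (z : ℂ) :
    evalC P z = (P.map GaussianInt.toComplex).eval z := (eval_map _ _).symm

theorem evalC_zero_right (P : GaussianInt[X]) :
    evalC P 0 = GaussianInt.toComplex (P.coeff 0) := by
  rw [evalC, eval₂_at_zero]

theorem toComplex_injective : Function.Injective GaussianInt.toComplex := fun _ _ h =>
  GaussianInt.toComplex_inj.1 h

theorem differentiable_evalC (P : GaussianInt[X]) : Differentiable ℂ (evalC P) := by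
  have : evalC P = fun z => (P.map GaussianInt.toComplex).eval z := funext (evalC_eq_eval_map P)
  rw [this]
  exact Polynomial.differentiable _

/-- A monic polynomial and a polynomial relatively prime to it have no common complex root. -/
theorem evalC_ne_zero_of_isRelPrime {P Q : GaussianInt[X]} (hP : P.Monic) (h : IsRelPrime P Q)
    {x : ℂ} (hx : evalC P x = 0) : evalC Q x ≠ 0 := by
  intro hQ
  let _ : Algebra GaussianInt ℂ := GaussianInt.toComplex.toAlgebra
  have : FaithfulSMul GaussianInt ℂ :=
    (faithfulSMul_iff_algebraMap_injective _ _).2 toComplex_injective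
  have : Module.IsTorsionFree GaussianInt ℂ := inferInstance
  -- Monicity makes `x` integral; as `ℤ[i]` is integrally closed, its minimal polynomial over `ℤ[i]`
  -- is then a nonunit common divisor.
  have hint : IsIntegral GaussianInt x := ⟨P, hP, hx⟩
  have h1 : minpoly GaussianInt x ∣ P := minpoly.isIntegrallyClosed_dvd hint hx
  have h2 : minpoly GaussianInt x ∣ Q := minpoly.isIntegrallyClosed_dvd hint hQ
  exact minpoly.not_isUnit GaussianInt x (h h1 h2)

theorem tendsto_phi_nhdsNE : Tendsto phi (𝓝[≠] 0) (𝓝[≠] 0) := by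
  have h := hasDerivAt_phi not_isPole_zero
  have hne := h.eventually_ne (c := 0) (by rw [psi_zero]; exact one_ne_zero)
  have hc := h.continuousAt.tendsto
  rw [phi_zero] at hc
  exact tendsto_nhdsWithin_iff.2 ⟨hc.mono_left nhdsWithin_le_nhds, hne⟩

theorem tendsto_phi_pow_four_nhdsNE : Tendsto (fun z => phi z ^ 4) (𝓝[≠] 0) (𝓝[≠] 0) := by
  obtain ⟨h1, h2⟩ := tendsto_nhdsWithin_iff.1 tendsto_phi_nhdsNE
  refine tendsto_nhdsWithin_iff.2 ⟨by simpa using h1.pow 4, ?_⟩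
  filter_upwards [h2] with z hz using pow_ne_zero 4 hz

theorem eventually_evalC_ne_zero {P : GaussianInt[X]} (hP : P ≠ 0) :
    ∀ᶠ z in 𝓝[≠] 0, evalC P (phi z ^ 4) ≠ 0 := by
  refine tendsto_phi_pow_four_nhdsNE.eventually (p := fun t => evalC P t ≠ 0) ?_
  have hP' : P.map GaussianInt.toComplex ≠ 0 := (Polynomial.map_ne_zero_iff toComplex_injective).2 hP
  refine nhdsNE_le_cofinite _ ?_
  refine ((P.map GaussianInt.toComplex).roots.toFinset.finite_toSet).subset fun t ht => ?_
  have : evalC P t = 0 := by simpa using ht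
  rw [evalC_eq_eval_map] at this
  simpa using ⟨fun h => hP (by simpa [Polynomial.map_eq_zero_iff toComplex_injective] using h), this⟩

/-- Near `0` the values `φ(z)⁴` are nonzero and tend to `0`, so they avoid the finitely many roots
of a nonzero polynomial. -/
theorem eq_of_eventually_evalC_eq {P Q : GaussianInt[X]}
    (h : ∀ᶠ z in 𝓝[≠] 0, evalC P (phi z ^ 4) = evalC Q (phi z ^ 4)) : P = Q := by
  by_contra hne
  have h' := eventually_evalC_ne_zero (sub_ne_zero.2 hne)
  obtain ⟨z, h1, h2⟩ := (h.and h').exists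
  rw [evalC_sub, h1, sub_self] at h2
  exact h2 rfl

theorem eventually_not_isPole_mul (c : ℂ) : ∀ᶠ z in 𝓝[≠] 0, ¬ IsPole (c * z) := by
  have h : Tendsto (fun z : ℂ => c * z) (𝓝[≠] 0) (𝓝 0) := by
    have : Continuous fun z : ℂ => c * z := by fun_prop
    simpa using (this.tendsto 0).mono_left nhdsWithin_le_nhds
  exact h.eventually (eventually_not_isPole not_isPole_zero)

theorem tendsto_mul_nhdsNE {c : ℂ} (hc : c ≠ 0) :
    Tendsto (fun z : ℂ => c * z) (𝓝[≠] 0) (𝓝[≠] 0) := by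
  have : Continuous fun z : ℂ => c * z := by fun_prop
  refine tendsto_nhdsWithin_iff.2
    ⟨by simpa using (this.tendsto 0).mono_left nhdsWithin_le_nhds, ?_⟩
  filter_upwards [self_mem_nhdsWithin] with z hz using mul_ne_zero hc hz

/-! ### Complex multiplication near the origin -/

/-- `φ (β z) = φ(z) A(φ(z)⁴) / B(φ(z)⁴)` for `z` near `0`. -/
def LocalMul (β : GaussianInt) (A B : GaussianInt[X]) : Prop :=
  ∀ᶠ z in 𝓝[≠] (0 : ℂ), phi (GaussianInt.toComplex β * z) * evalC B (phi z ^ 4) =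
    phi z * evalC A (phi z ^ 4)

/-- `φ (β z)` is `φ z` times a quotient of polynomials in `φ(z)⁴` with coefficients in `ℤ[i]`, the
denominator having constant term `1`. -/
def HasLocalMul (β : GaussianInt) : Prop :=
  ∃ A B : GaussianInt[X], B.coeff 0 = 1 ∧ LocalMul β A B

/-- The values of `φ` and its derivative at `η z` for `η` of norm `2`. -/
def IsStep (η : GaussianInt) : Prop :=
  ∀ᶠ z in 𝓝[≠] (0 : ℂ),
    phi (GaussianInt.toComplex η * z) ^ 2 * (1 - phi z ^ 4) =
      GaussianInt.toComplex η ^ 2 * phi z ^ 2 ∧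
    psi (GaussianInt.toComplex η * z) * (1 - phi z ^ 4) = 1 + phi z ^ 4

theorem isStep_one_add_gI : IsStep (1 + gI) := by
  have hne : ∀ᶠ z in 𝓝[≠] (0 : ℂ), evalC (1 - X) (phi z ^ 4) ≠ 0 :=
    eventually_evalC_ne_zero fun h => by
      have := congrArg (fun p : GaussianInt[X] => p.coeff 0) h
      simp at this
  filter_upwards [hne, eventually_not_isPole_mul 1, eventually_not_isPole_mul (1 + Complex.I)]
    with z h0 h1 h2
  rw [one_mul] at h1
  rw [evalC_sub, evalC_one, evalC_X] at h0
  have e := phi_one_add_I_mul h1 h2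
  have e' := psi_one_add_I_mul h1 h2
  have hs := psi_sq h1
  rw [map_add, map_one, toComplex_gI]
  constructor
  · apply mul_right_cancel₀ h0
    linear_combination (phi ((1 + Complex.I) * z) * (1 - phi z ^ 4) +
      (1 + Complex.I) * phi z * psi z) * e + (1 + Complex.I) ^ 2 * phi z ^ 2 * hs
  · apply mul_right_cancel₀ h0
    linear_combination e'

theorem IsStep.gI_mul {η : GaussianInt} (h : IsStep η) : IsStep (gI * η) := by
  filter_upwards [h, eventually_not_isPole_mul (GaussianInt.toComplex η)] with z hz hp
  rw [map_mul, toComplex_gI, mul_assoc, phi_I_mul, psi_I_mul hp]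
  refine ⟨?_, hz.2⟩
  rw [mul_pow, mul_pow]
  linear_combination Complex.I ^ 2 * hz.1

theorem IsStep.neg {η : GaussianInt} (h : IsStep η) : IsStep (-η) := by
  filter_upwards [h] with z hz
  rw [map_neg, neg_mul, phi_neg, psi_neg, neg_sq, neg_sq]
  exact hz

/-- With `u = φ(βz)`, `v = φ(ηz)`, the sum `φ((β + η)z) + φ((β - η)z)` equals `2 u ψ(ηz) / (1 + u²
v²)`: the term containing `ψ(βz)` cancels. Only `v²` and `ψ(ηz)` remain, and these are what `IsStep`
expresses through `φ(z)`. -/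
theorem HasLocalMul.add_step {β η : GaussianInt} (hη : IsStep η) (h0 : HasLocalMul β)
    (h1 : HasLocalMul (β - η)) : HasLocalMul (β + η) := by
  obtain ⟨A0, B0, hB0, h0⟩ := h0
  obtain ⟨A1, B1, hB1, h1⟩ := h1
  refine ⟨(A0 + A0) * B0 * (1 + X) * B1 - A1 * (B0 ^ 2 * (1 - X) + C (η ^ 2) * X * A0 ^ 2),
    B1 * (B0 ^ 2 * (1 - X) + C (η ^ 2) * X * A0 ^ 2), ?_, ?_⟩
  · simp [coeff_zero_eq_eval_zero] at hB0 hB1 ⊢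
    simp [hB0, hB1]
  · filter_upwards [hη, h0, h1, eventually_not_isPole_mul (GaussianInt.toComplex β),
      eventually_not_isPole_mul (GaussianInt.toComplex η),
      eventually_not_isPole_mul (GaussianInt.toComplex (β + η)),
      eventually_not_isPole_mul (GaussianInt.toComplex (β - η))] with z hη h0 h1 hp1 hp2 hp3 hp4
    have e1 : GaussianInt.toComplex (β + η) * z =
        GaussianInt.toComplex β * z + GaussianInt.toComplex η * z := by rw [map_add]; ring
    have e2 : GaussianInt.toComplex (β - η) * z =
        GaussianInt.toComplex β * z + -(GaussianInt.toComplex η * z) := by rw [map_sub]; ring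
    rw [e1] at hp3 ⊢
    rw [e2] at hp4 h1
    have k1 := phi_add hp1 hp2 hp3
    have k2 := phi_add hp1 (by rwa [isPole_neg]) hp4
    rw [phi_neg, psi_neg] at k2
    obtain ⟨m1, m2⟩ := hη
    simp only [evalC_sub, evalC_mul, evalC_add, evalC_pow, evalC_C, evalC_X, evalC_one,
      map_pow]
    generalize phi (GaussianInt.toComplex β * z + GaussianInt.toComplex η * z) = p at *
    generalize phi (GaussianInt.toComplex β * z + -(GaussianInt.toComplex η * z)) = q at *
    generalize phi (GaussianInt.toComplex β * z) = u at *
    generalize phi (GaussianInt.toComplex η * z) = v at *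
    generalize psi (GaussianInt.toComplex β * z) = u' at *
    generalize psi (GaussianInt.toComplex η * z) = v' at *
    generalize phi z = x at *
    generalize evalC A0 (x ^ 4) = a0 at *
    generalize evalC B0 (x ^ 4) = b0 at *
    generalize evalC A1 (x ^ 4) = a1 at *
    generalize evalC B1 (x ^ 4) = b1 at *
    generalize GaussianInt.toComplex η = e at *
    -- The second factor of the new denominator is `1 + u² v²` cleared of its own denominators.
    have hE : (1 + u ^ 2 * v ^ 2) * (1 - x ^ 4) * b0 ^ 2 =
        b0 ^ 2 * (1 - x ^ 4) + e ^ 2 * x ^ 4 * a0 ^ 2 := by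
      linear_combination u ^ 2 * b0 ^ 2 * m1 + e ^ 2 * x ^ 2 * (u * b0 + x * a0) * h0
    rw [← hE]
    linear_combination (1 - x ^ 4) * b0 ^ 2 * b1 * (k1 + k2) +
      2 * u * b0 ^ 2 * b1 * m2 + 2 * b0 * b1 * (1 + x ^ 4) * h0 -
      (1 + u ^ 2 * v ^ 2) * (1 - x ^ 4) * b0 ^ 2 * h1

theorem HasLocalMul.add_int_mul {β η : GaussianInt} (hη : IsStep η) (h0 : HasLocalMul β)
    (h1 : HasLocalMul (β - η)) (n : ℤ) : HasLocalMul (β + n * η) := by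
  -- The recurrence has order two, so consecutive values are carried together; downwards it runs
  -- with step `-η`.
  suffices h : HasLocalMul (β + n * η) ∧ HasLocalMul (β + n * η - η) from h.1
  induction n using Int.induction_on with
  | zero => simpa using ⟨h0, h1⟩
  | succ k ih =>
    have := HasLocalMul.add_step hη ih.1 ih.2
    have e : β + ((k + 1 : ℤ) : GaussianInt) * η = β + ((k : ℤ) : GaussianInt) * η + η := by
      push_cast; ring
    rw [e, add_sub_cancel_right]
    exact ⟨this, ih.1⟩
  | pred k ih =>
    have := HasLocalMul.add_step hη.neg ih.2 (by rw [sub_neg_eq_add, sub_add_cancel]; exact ih.1)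
    have e : β + ((-k - 1 : ℤ) : GaussianInt) * η = β + ((-k : ℤ) : GaussianInt) * η - η := by
      push_cast; ring
    rw [e]
    exact ⟨ih.2, by rwa [← sub_eq_add_neg] at this⟩

theorem hasLocalMul_of_forall {β : GaussianInt}
    (h : ∀ z, phi (GaussianInt.toComplex β * z) = GaussianInt.toComplex β * phi z) :
    HasLocalMul β := by
  refine ⟨C β, 1, by simp, Filter.Eventually.of_forall fun z => ?_⟩
  rw [h, evalC_one, evalC_C]
  ring

theorem IsOdd.hasLocalMul {β : GaussianInt} (hβ : IsOdd β) : HasLocalMul β := by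
  obtain ⟨κ, rfl⟩ := hβ.exists_eq
  have b0 : HasLocalMul 1 := hasLocalMul_of_forall fun z => by simp
  have b1 : HasLocalMul gI := hasLocalMul_of_forall fun z => by rw [toComplex_gI, phi_I_mul]
  have b2 : HasLocalMul (1 - (1 + gI)) := hasLocalMul_of_forall fun z => by
    rw [show 1 - (1 + gI) = -gI by ring, map_neg, toComplex_gI, neg_mul, phi_neg, phi_I_mul]
    ring
  have b3 : HasLocalMul (gI - (1 + gI)) := hasLocalMul_of_forall fun z => by
    rw [show gI - (1 + gI) = -1 by ring, map_neg, map_one, neg_one_mul, phi_neg]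
    ring
  have h1 := HasLocalMul.add_int_mul isStep_one_add_gI b0 b2 κ.re
  have h2 := HasLocalMul.add_int_mul isStep_one_add_gI b1 b3 κ.re
  have hs := isStep_one_add_gI.gI_mul
  have e1 : 1 + (κ.re : GaussianInt) * (1 + gI) =
      gI + (κ.re : GaussianInt) * (1 + gI) - gI * (1 + gI) := by
    linear_combination gI_sq
  -- The rows `1 + n(1 + i)` and `i + n(1 + i)` differ by the step `i(1 + i)` and correspond to
  -- `κ.im = 0` and `κ.im = 1`. The second row is the base of the recurrence, hence `κ.im - 1`.
  have h3 := HasLocalMul.add_int_mul hs h2 (by rw [← e1]; exact h1) (κ.im - 1)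
  convert h3 using 1
  have hκ : κ = κ.re + κ.im * gI := by
    rw [Zsqrtd.ext_iff]
    simp [gI]
  nth_rw 1 [hκ]
  push_cast
  linear_combination gI_sq

/-! ### The numerator and denominator of the multiplication formula -/

theorem countable_isPole_or_mul {c : ℂ} (hc : c ≠ 0) : {z | IsPole z ∨ IsPole (c * z)}.Countable :=
  countable_isPole.union (countable_isPole.preimage (mul_right_injective₀ hc))

theorem isClosed_isPole_or_mul (c : ℂ) : IsClosed {z | IsPole z ∨ IsPole (c * z)} :=
  isClosed_isPole.union (isClosed_isPole.preimage (continuous_const_mul c))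

/-- The multiplication formula holds globally if it holds near `0`. -/
theorem LocalMul.eq {β : GaussianInt} {A B : GaussianInt[X]} (h : LocalMul β A B) (hβ : β ≠ 0)
    {z : ℂ} (hz : ¬ IsPole z) (hz' : ¬ IsPole (GaussianInt.toComplex β * z)) :
    phi (GaussianInt.toComplex β * z) * evalC B (phi z ^ 4) = phi z * evalC A (phi z ^ 4) := by
  set s := {z | IsPole z ∨ IsPole (GaussianInt.toComplex β * z)} with hs
  have hconn : IsPreconnected sᶜ :=
    ((countable_isPole_or_mul (toComplex_ne_zero hβ)).isConnected_compl_of_one_lt_rank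
      (by rw [Complex.rank_real_complex]; norm_num)).isPreconnected
  have hopen : IsOpen sᶜ := (isClosed_isPole_or_mul _).isOpen_compl
  have h0 : (0 : ℂ) ∈ sᶜ := by
    simp [hs, not_isPole_zero]
  have hf : AnalyticOnNhd ℂ (fun z => phi (GaussianInt.toComplex β * z) * evalC B (phi z ^ 4)) sᶜ := by
    refine DifferentiableOn.analyticOnNhd (fun w hw => ?_) hopen
    have h1 := differentiableAt_phi (not_or.1 hw).1
    have h2 := DifferentiableAt.comp w (differentiableAt_phi (not_or.1 hw).2)
      (differentiableAt_id.const_mul (GaussianInt.toComplex β))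
    exact (h2.mul ((differentiable_evalC B).differentiableAt.comp w
      (h1.pow 4))).differentiableWithinAt
  have hg : AnalyticOnNhd ℂ (fun z => phi z * evalC A (phi z ^ 4)) sᶜ := by
    refine DifferentiableOn.analyticOnNhd (fun w hw => ?_) hopen
    have h1 := differentiableAt_phi (not_or.1 hw).1
    exact (h1.mul ((differentiable_evalC A).differentiableAt.comp w
      (h1.pow 4))).differentiableWithinAt
  exact hf.eqOn_of_preconnected_of_frequently_eq hg hconn h0 h.frequently (not_or.2 ⟨hz, hz'⟩)

theorem IsOdd.exists_isRelPrime {β : GaussianInt} (hβ : IsOdd β) :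
    ∃ A B : GaussianInt[X], IsRelPrime A B ∧ IsUnit (B.coeff 0) ∧ LocalMul β A B := by
  obtain ⟨A, B, hB, h⟩ := hβ.hasLocalMul
  have hB0 : B ≠ 0 := by
    rintro rfl
    simp at hB
  obtain ⟨B', A', c, hrel, rfl, rfl⟩ := UniqueFactorizationMonoid.exists_reduced_factors B hB0 A
  rw [mul_coeff_zero] at hB
  refine ⟨A', B', hrel.symm, IsUnit.of_mul_eq_one_right _ hB, ?_⟩
  have hc : c ≠ 0 := left_ne_zero_of_mul hB0
  filter_upwards [h, eventually_evalC_ne_zero hc] with z hz hcz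
  rw [evalC_mul, evalC_mul] at hz
  apply mul_left_cancel₀ hcz
  linear_combination hz

theorem evalC_reflect {P : GaussianInt[X]} {n : ℕ} (hn : P.natDegree ≤ n) {t : ℂ} (ht : t ≠ 0) :
    evalC (P.reflect n) t = t ^ n * evalC P t⁻¹ := by
  let _ : Invertible t⁻¹ := invertibleOfNonzero (inv_ne_zero ht)
  have h := eval₂_reflect_mul_pow GaussianInt.toComplex t⁻¹ n P hn
  rw [invOf_eq_inv, inv_inv] at h
  rw [evalC, evalC, ← h, mul_comm, mul_assoc, ← mul_pow, inv_mul_cancel₀ ht, one_pow, mul_one]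

theorem eventually_not_isPole_add_omega {c : ℂ} (hc : c ≠ 0) :
    ∀ᶠ z in 𝓝[≠] (0 : ℂ), ¬ IsPole (c * z + omega) ∧ phi (c * z) ≠ 0 := by
  have h := tendsto_phi_nhdsNE.comp (tendsto_mul_nhdsNE hc)
  filter_upwards [(tendsto_nhdsWithin_iff.1 h).2, eventually_not_isPole_mul c] with z hz hp
  have hz : phi (c * z) ≠ 0 := hz
  refine ⟨?_, hz⟩
  rwa [isPole_add_omega, ← phi_eq_zero_iff hp]

/-- The symmetry of numerator and denominator that comes from translation by the pole `ω`. -/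
theorem LocalMul.reflect_mul {β : GaussianInt} {A B : GaussianInt[X]} (h : LocalMul β A B)
    (hβ : IsOdd β) {n : ℕ} (hA : A.natDegree ≤ n) (hB : B.natDegree ≤ n) :
    ∃ e : ℤ, A.reflect n * A = C ((-1) ^ e.natAbs) * (B.reflect n * B) := by
  obtain ⟨κ, hκ⟩ := hβ.mul_omega
  have hβ0 := toComplex_ne_zero hβ.ne_zero
  refine ⟨κ.re + κ.im, eq_of_eventually_evalC_eq ?_⟩
  filter_upwards [h, eventually_not_isPole_mul 1, eventually_not_isPole_add_omega one_ne_zero,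
    eventually_not_isPole_mul (GaussianInt.toComplex β),
    eventually_not_isPole_add_omega hβ0] with z h0 hp1 hp2 hp3 hp4
  rw [one_mul] at hp1 hp2
  obtain ⟨hp2, hx⟩ := hp2
  obtain ⟨hp4, hu⟩ := hp4
  have e1 : GaussianInt.toComplex β * (z + omega) =
      GaussianInt.toComplex β * z + omega + varpi * GaussianInt.toComplex κ := by
    rw [mul_add, hκ]; ring
  -- The formula is evaluated at `z + ω`, where `φ⁴` becomes `φ(z)⁻⁴`; comparison with the formula
  -- at `z` relates the polynomials to their reflections.
  have key := h.eq hβ.ne_zero hp2 (by rwa [e1, isPole_add_lattice])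
  rw [e1, phi_add_lattice] at key
  have k1 := phi_add_omega_mul hp1 hp2
  have k2 := phi_add_omega_mul hp3 hp4
  have k1' : phi (z + omega) = -Complex.I / phi z := by rw [eq_div_iff hx, k1]
  have k2' : phi (GaussianInt.toComplex β * z + omega) =
      -Complex.I / phi (GaussianInt.toComplex β * z) := by rw [eq_div_iff hu, k2]
  have ht : (-Complex.I / phi z) ^ 4 = (phi z ^ 4)⁻¹ := by
    rw [div_pow, Even.neg_pow (by decide), Complex.I_pow_four, one_div]
  rw [k1', k2', ht] at key
  have ht0 : phi z ^ 4 ≠ 0 := pow_ne_zero 4 hx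
  have hsign : ((-1 : ℂ) ^ (κ.re + κ.im)) = (-1) ^ (κ.re + κ.im).natAbs := by
    rcases Int.natAbs_eq (κ.re + κ.im) with hh | hh
    · nth_rw 1 [hh]
      rw [zpow_natCast]
    · nth_rw 1 [hh]
      rw [zpow_neg, zpow_natCast, ← inv_pow]
      norm_num
  rw [hsign] at key
  rw [evalC_mul, evalC_mul, evalC_mul, evalC_C, map_pow, map_neg, map_one, evalC_reflect hA ht0,
    evalC_reflect hB ht0]
  generalize phi (GaussianInt.toComplex β * z) = u at *
  generalize phi z = x at *
  generalize evalC A (x ^ 4) = a at *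
  generalize evalC B (x ^ 4) = b at *
  generalize evalC A (x ^ 4)⁻¹ = a' at *
  generalize evalC B (x ^ 4)⁻¹ = b' at *
  generalize (-1 : ℂ) ^ (κ.re + κ.im).natAbs = σ at *
  have hI := Complex.I_ne_zero
  have key' : σ * x * b' = u * a' := by
    field_simp at key
    linear_combination -key
  have : x * (a' * a) = x * (σ * (b' * b)) := by linear_combination -b * key' - a' * h0
  linear_combination (x ^ 4) ^ n * mul_left_cancel₀ hx this

/-- By `LocalMul.reflect_mul` and coprimality, `A` divides the reflection of `B`. The leading
coefficient of that reflection is `B.coeff 0`, a unit, so the one of `A` is a unit as well. -/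
theorem IsOdd.exists_monic {β : GaussianInt} (hβ : IsOdd β) :
    ∃ P B : GaussianInt[X], P.Monic ∧ IsRelPrime P B ∧ IsUnit (B.coeff 0) ∧ LocalMul β P B := by
  obtain ⟨A, B, hrel, hB, h⟩ := hβ.exists_isRelPrime
  set n := max A.natDegree B.natDegree with hn
  have hBn : B.natDegree ≤ n := le_max_right _ _
  obtain ⟨e, he⟩ := h.reflect_mul hβ (le_max_left _ _) hBn
  have hdvd : A ∣ B.reflect n := by
    have h1 : A ∣ C ((-1) ^ e.natAbs) * B.reflect n * B :=
      ⟨A.reflect n, by rw [mul_assoc, ← he]; ring⟩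
    have h2 := hrel.dvd_of_dvd_mul_right h1
    have h3 : IsUnit (C ((-1 : GaussianInt) ^ e.natAbs)) :=
      (isUnit_one.neg.pow _).map C
    exact (h3.dvd_mul_left).1 h2
  have hcoeff : (B.reflect n).coeff n = B.coeff 0 := by
    rw [coeff_reflect, revAt_le le_rfl, Nat.sub_self]
  have hdeg : (B.reflect n).natDegree = n := by
    refine le_antisymm (natDegree_reflect_le.trans (max_le le_rfl hBn)) ?_
    exact le_natDegree_of_ne_zero (by rw [hcoeff]; exact hB.ne_zero)
  have hlc : IsUnit A.leadingCoeff := by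
    refine isUnit_of_dvd_unit (leadingCoeff_dvd_leadingCoeff hdvd) ?_
    rw [leadingCoeff, hdeg, hcoeff]
    exact hB
  obtain ⟨u, hu⟩ := hlc
  have hP : (C (↑u⁻¹ : GaussianInt) * A).Monic := by
    rw [Monic, leadingCoeff_mul, leadingCoeff_C, ← hu, Units.inv_mul]
  have hA : A = C (u : GaussianInt) * (C (↑u⁻¹ : GaussianInt) * A) := by
    rw [← mul_assoc, ← C_mul, Units.mul_inv, C_1, one_mul]
  refine ⟨C (↑u⁻¹ : GaussianInt) * A, C (↑u⁻¹ : GaussianInt) * B, hP, ?_, ?_, ?_⟩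
  · have hunit : IsUnit (C (↑u⁻¹ : GaussianInt)) := (Units.isUnit _).map C
    exact (isRelPrime_mul_unit_left hunit).2 hrel
  · rw [coeff_C_mul]
    exact (Units.isUnit _).mul hB
  · filter_upwards [h] with z hz
    rw [evalC_mul, evalC_mul]
    linear_combination evalC (C (↑u⁻¹ : GaussianInt)) (phi z ^ 4) * hz

/-- In `β = 1 + (1 + i) κ` only `κ` modulo `2` matters, and its four parity classes give the four
powers of `i`. -/
theorem IsOdd.exists_pow_gI {β : GaussianInt} (hβ : IsOdd β) :
    ∃ ε < 4, 2 * (1 + gI) ∣ β - gI ^ ε := by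
  obtain ⟨κ, rfl⟩ := hβ.exists_eq
  have hκ : κ = κ.re + κ.im * gI := by
    rw [Zsqrtd.ext_iff]
    simp [gI]
  have h2 := gI_sq
  rcases Int.even_or_odd' κ.re with ⟨a, ha | ha⟩ <;> rcases Int.even_or_odd' κ.im with ⟨b, hb | hb⟩
  all_goals
    rw [hκ, ha, hb]
    push_cast
  · exact ⟨0, by norm_num, a + b * gI, by ring⟩
  · exact ⟨1, by norm_num, a + b * gI, by linear_combination h2⟩
  · exact ⟨3, by norm_num, a + 1 + b * gI, by linear_combination (-gI) * h2⟩
  · exact ⟨2, by norm_num, a + 1 + b * gI, by ring⟩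

theorem IsOdd.exists_isMulNumerator {β : GaussianInt} (hβ : IsOdd β) :
    ∃ P, IsMulNumerator β P := by
  obtain ⟨P, B, hP, hrel, hB, h⟩ := hβ.exists_monic
  obtain ⟨ε, hε, hdvd⟩ := hβ.exists_pow_gI
  have hunit : IsUnit (C (gI ^ ε)) := by
    refine (IsUnit.pow _ ?_).map C
    exact IsUnit.of_mul_eq_one (-gI) (by linear_combination -gI_sq)
  -- The prescribed factor `i ^ ε` is compensated in the denominator.
  refine ⟨P, hP, C (gI ^ ε) * B, ε, ?_, hε, hdvd, fun z hz hz' => ?_⟩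
  · exact (isRelPrime_mul_unit_left_right hunit).2 hrel
  · have key := h.eq hβ.ne_zero hz hz'
    have hI : Complex.I ^ ε ≠ 0 := pow_ne_zero _ Complex.I_ne_zero
    -- A zero of `B` would force `φ(z) = 0`, excluded by the constant term, or a common zero with
    -- `P`, excluded by coprimality.
    have hB0 : evalC B (phi z ^ 4) ≠ 0 := by
      intro h0
      rw [h0, mul_zero] at key
      rcases mul_eq_zero.1 key.symm with h1 | h1
      · rw [h1, zero_pow (by norm_num), evalC_zero_right] at h0
        exact toComplex_ne_zero hB.ne_zero h0
      · exact evalC_ne_zero_of_isRelPrime hP hrel h1 h0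
    rw [evalC_mul, evalC_C, map_pow, toComplex_gI]
    refine ⟨mul_ne_zero hI hB0, ?_⟩
    field_simp
    linear_combination key

/-! ### Uniqueness -/

theorem IsMulNumerator.unique {β : GaussianInt} {P P' : GaussianInt[X]}
    (h : IsMulNumerator β P) (h' : IsMulNumerator β P') : P = P' := by
  have hdvd : ∀ {P P' : GaussianInt[X]}, IsMulNumerator β P → IsMulNumerator β P' → P ∣ P' := by
    rintro P P' ⟨hP, Q, ε, hrel, -, -, h⟩ ⟨hP', Q', ε', -, -, -, h'⟩
    have key : C (gI ^ ε) * P * Q' = C (gI ^ ε') * P' * Q := by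
      refine eq_of_eventually_evalC_eq ?_
      filter_upwards [eventually_not_isPole_mul 1, eventually_not_isPole_mul _,
        eventually_not_isPole_add_omega one_ne_zero] with z hp hp' hx
      rw [one_mul] at hp hx
      obtain ⟨hQ, e⟩ := h z hp hp'
      obtain ⟨hQ', e'⟩ := h' z hp hp'
      rw [evalC_mul, evalC_mul, evalC_mul, evalC_mul, evalC_C, evalC_C, map_pow, map_pow,
        toComplex_gI]
      rw [e] at e'
      have hx := hx.2
      field_simp at e'
      linear_combination e'
    have h1 : P ∣ C (gI ^ ε') * P' * Q := ⟨C (gI ^ ε) * Q', by rw [← key]; ring⟩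
    have h2 := hrel.dvd_of_dvd_mul_right h1
    have hunit : IsUnit (C (gI ^ ε')) := by
      refine (IsUnit.pow _ ?_).map C
      exact IsUnit.of_mul_eq_one (-gI) (by linear_combination -gI_sq)
    exact (hunit.dvd_mul_left).1 h2
  exact eq_of_monic_of_associated h.1 h'.1 (associated_of_dvd_dvd (hdvd h h') (hdvd h' h))

/-! ### Torsion points -/

theorem toComplex_mul_delta {β : GaussianInt} (hβ : β ≠ 0) (α : GaussianInt) :
    GaussianInt.toComplex β * (GaussianInt.toComplex α * delta β) =
      varpi * GaussianInt.toComplex ((1 + gI) * α) := by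
  have := toComplex_ne_zero hβ
  rw [delta, map_mul, map_add, map_one, toComplex_gI]
  field_simp

theorem IsOdd.not_isPole_delta {β : GaussianInt} (hβ : IsOdd β) (α : GaussianInt) :
    ¬ IsPole (GaussianInt.toComplex α * delta β) :=
  hβ.not_isPole (toComplex_mul_delta hβ.ne_zero α)

theorem IsOdd.phi_delta_eq_zero_iff {β : GaussianInt} (hβ : IsOdd β) {α : GaussianInt} :
    phi (GaussianInt.toComplex α * delta β) = 0 ↔ β ∣ α := by
  have h0 := toComplex_ne_zero hβ.ne_zero
  rw [phi_eq_zero_iff (hβ.not_isPole_delta α)]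
  constructor
  · rintro ⟨γ, hγ⟩
    refine hβ.dvd_of_dvd_mul_left ⟨γ, toComplex_injective ?_⟩
    apply mul_left_cancel₀ varpi_ne_zero
    rw [← toComplex_mul_delta hβ.ne_zero, hγ, map_mul]
    ring
  · rintro ⟨κ, rfl⟩
    refine ⟨(1 + gI) * κ, mul_left_cancel₀ h0 ?_⟩
    rw [toComplex_mul_delta hβ.ne_zero]
    simp only [map_mul]
    ring

/-- The factor `1 + i` in `δ_β` matters here: the shift lies in `(1 + i) ϖ ℤ[i]`, where the sign in
`phi_add_lattice` is trivial. -/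
theorem phi_delta_eq_of_dvd {β : GaussianInt} (hβ : β ≠ 0) {α α' : GaussianInt} (h : β ∣ α - α') :
    phi (GaussianInt.toComplex α * delta β) = phi (GaussianInt.toComplex α' * delta β) := by
  obtain ⟨κ, hκ⟩ := h
  have h0 := toComplex_ne_zero hβ
  have e : GaussianInt.toComplex α * delta β =
      GaussianInt.toComplex α' * delta β + varpi * GaussianInt.toComplex ((1 + gI) * κ) := by
    apply mul_left_cancel₀ h0
    rw [mul_add, toComplex_mul_delta hβ, toComplex_mul_delta hβ, eq_add_of_sub_eq hκ]
    simp only [map_mul, map_add]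
    ring
  have hev := one_add_gI_dvd_iff.1 (dvd_mul_right (1 + gI) κ)
  rw [e, phi_add_lattice, hev.neg_one_zpow, one_mul]

/-- The values of `φ` at the torsion points for an odd `β` are distinct. -/
theorem IsOdd.dvd_sub_of_phi_delta_eq {β : GaussianInt} (hβ : IsOdd β) {α α' : GaussianInt}
    (h : phi (GaussianInt.toComplex α * delta β) = phi (GaussianInt.toComplex α' * delta β)) :
    β ∣ α - α' := by
  have e1 : GaussianInt.toComplex α * delta β - GaussianInt.toComplex α' * delta β =
      GaussianInt.toComplex (α - α') * delta β := by rw [map_sub]; ring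
  have e2 : GaussianInt.toComplex α * delta β + GaussianInt.toComplex α' * delta β =
      GaussianInt.toComplex (α + α') * delta β := by rw [map_add]; ring
  have e3 : GaussianInt.toComplex α * delta β + GaussianInt.toComplex α * delta β =
      GaussianInt.toComplex (α + α) * delta β := by rw [map_add]; ring
  have key := phi_sub_or_phi_add_eq_zero (hβ.not_isPole_delta α) (hβ.not_isPole_delta α')
    (e1 ▸ hβ.not_isPole_delta _) (e2 ▸ hβ.not_isPole_delta _) (e3 ▸ hβ.not_isPole_delta _) h
  rw [e1, e2, hβ.phi_delta_eq_zero_iff, hβ.phi_delta_eq_zero_iff] at key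
  rcases key with h1 | h1
  · exact h1
  -- If `β` divides `α + α'`, the two equal values are also opposite, hence zero, and `β` divides
  -- both `α` and `α'`.
  · have h2 : phi (GaussianInt.toComplex α' * delta β) =
        -phi (GaussianInt.toComplex α * delta β) := by
      rw [← phi_neg, ← neg_mul, ← map_neg]
      refine phi_delta_eq_of_dvd hβ.ne_zero ?_
      rwa [sub_neg_eq_add, add_comm]
    have h3 : phi (GaussianInt.toComplex α * delta β) = 0 := by
      rw [← h] at h2
      linear_combination h2 / 2
    have h4 := hβ.phi_delta_eq_zero_iff.1 h3
    have h5 := hβ.phi_delta_eq_zero_iff.1 (h ▸ h3)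
    exact dvd_sub h4 h5

/-! ### The roots of the division polynomial -/

theorem eval_divisionPoly (P : GaussianInt[X]) (x : ℂ) :
    (divisionPoly P).eval x = x * evalC P (x ^ 4) := by
  rw [divisionPoly, evalC_eq_eval_map]
  simp [Polynomial.map_comp]

theorem monic_divisionPoly {P : GaussianInt[X]} (hP : P.Monic) : (divisionPoly P).Monic := by
  refine Monic.map _ (monic_X.mul (hP.comp (monic_X_pow 4) ?_))
  simp

/-- At the preimages of the roots of the division polynomial, `φ (β z)` is finite. -/
theorem not_isPole_mul_of_root {β : GaussianInt} (hβ : IsOdd β) {P : GaussianInt[X]}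
    (h : IsMulNumerator β P) {z : ℂ} (hz : ¬ IsPole z) (hx : (divisionPoly P).eval (phi z) = 0) :
    ¬ IsPole (GaussianInt.toComplex β * z) := by
  obtain ⟨hP, Q, ε, hrel, -, -, h⟩ := h
  have hβ0 := toComplex_ne_zero hβ.ne_zero
  intro hpole
  obtain ⟨κ, hκ⟩ := isPole_iff.1 hpole
  set σ : ℂ := (-1) ^ (κ.re + κ.im) with hσ
  have hσ0 : σ ≠ 0 := zpow_ne_zero _ (by norm_num)
  have htz : Tendsto (fun w => z + w) (𝓝[≠] 0) (𝓝 z) := by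
    have : Continuous fun w : ℂ => z + w := by fun_prop
    simpa using (this.tendsto 0).mono_left nhdsWithin_le_nhds
  have htphi : Tendsto (fun w => phi (z + w)) (𝓝[≠] 0) (𝓝 (phi z)) :=
    (differentiableAt_phi hz).continuousAt.tendsto.comp htz
  have hL : Tendsto (fun w => σ * -Complex.I * evalC Q (phi (z + w) ^ 4)) (𝓝[≠] 0)
      (𝓝 (σ * -Complex.I * evalC Q (phi z ^ 4))) :=
    (((differentiable_evalC Q).continuous.tendsto _).comp (htphi.pow 4)).const_mul _
  have hR : Tendsto (fun w => Complex.I ^ ε * (divisionPoly P).eval (phi (z + w)) *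
      phi (GaussianInt.toComplex β * w)) (𝓝[≠] 0)
      (𝓝 (Complex.I ^ ε * (divisionPoly P).eval (phi z) * 0)) := by
    refine ((((divisionPoly P).continuous.tendsto _).comp htphi).const_mul _).mul ?_
    exact (tendsto_nhdsWithin_iff.1 (tendsto_phi_nhdsNE.comp (tendsto_mul_nhdsNE hβ0))).1
  -- If `βz` were a pole, `φ(β(z + w)) = σ(-i) / φ(βw)`. Clearing denominators and letting `w → 0`
  -- forces `Q(φ(z)⁴) = 0`.
  have heq : (fun w => σ * -Complex.I * evalC Q (phi (z + w) ^ 4)) =ᶠ[𝓝[≠] 0]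
      (fun w => Complex.I ^ ε * (divisionPoly P).eval (phi (z + w)) *
        phi (GaussianInt.toComplex β * w)) := by
    filter_upwards [htz.eventually (eventually_not_isPole hz),
      eventually_not_isPole_mul (GaussianInt.toComplex β),
      eventually_not_isPole_add_omega hβ0] with w h1 h2 h3
    have e : GaussianInt.toComplex β * (z + w) =
        GaussianInt.toComplex β * w + omega + varpi * GaussianInt.toComplex κ := by
      rw [mul_add, hκ]; ring
    have hp : ¬ IsPole (GaussianInt.toComplex β * (z + w)) := by
      rw [e, isPole_add_lattice]
      exact h3.1
    obtain ⟨hQ, k⟩ := h _ h1 hp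
    rw [e, phi_add_lattice, ← hσ] at k
    have k2 := phi_add_omega_mul h2 h3.1
    rw [eval_divisionPoly]
    field_simp at k
    linear_combination phi (GaussianInt.toComplex β * w) * k -
      σ * evalC Q (phi (z + w) ^ 4) * k2
  have hlim := tendsto_nhds_unique (hL.congr' heq) hR
  rw [mul_zero] at hlim
  have hQ0 : evalC Q (phi z ^ 4) = 0 :=
    (mul_eq_zero.1 hlim).resolve_left (mul_ne_zero hσ0 (neg_ne_zero.2 Complex.I_ne_zero))
  rw [eval_divisionPoly] at hx
  rcases mul_eq_zero.1 hx with h0 | h0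
  · have := (h 0 not_isPole_zero (by rw [mul_zero]; exact not_isPole_zero)).1
    rw [phi_zero] at this
    rw [h0] at hQ0
    exact this hQ0
  · exact evalC_ne_zero_of_isRelPrime hP hrel h0 hQ0

theorem IsMulNumerator.isRoot_iff {β : GaussianInt} (hβ : IsOdd β) {P : GaussianInt[X]}
    (h : IsMulNumerator β P) {x : ℂ} :
    (divisionPoly P).IsRoot x ↔
      ∃ α : GaussianInt, phi (GaussianInt.toComplex α * delta β) = x := by
  have hβ0 := toComplex_ne_zero hβ.ne_zero
  constructor
  · intro hx
    obtain ⟨z, hz, rfl⟩ := exists_phi_eq x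
    have hp := not_isPole_mul_of_root hβ h hz hx
    obtain ⟨-, Q, ε, -, -, -, h⟩ := h
    obtain ⟨-, k⟩ := h z hz hp
    have hzero : phi (GaussianInt.toComplex β * z) = 0 := by
      rw [k]
      rw [IsRoot, eval_divisionPoly] at hx
      linear_combination Complex.I ^ ε / evalC Q (phi z ^ 4) * hx
    obtain ⟨γ, hγ⟩ := (phi_eq_zero_iff hp).1 hzero
    have hβ' := hβ.ne_zero
    obtain ⟨a, b, hab⟩ := hβ
    -- Bézout for `β` and `1 + i` splits `z = ϖγ/β` into a multiple of `δ_β` and a point of `ϖ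
    -- ℤ[i]`. The latter changes `φ` by at most a sign, absorbed by `α ↦ -α`.
    have e : z = GaussianInt.toComplex (b * γ) * delta β +
        varpi * GaussianInt.toComplex (a * γ) := by
      apply mul_left_cancel₀ hβ0
      rw [mul_add, toComplex_mul_delta hβ', hγ]
      have hab' : γ = (1 + gI) * (b * γ) + β * (a * γ) := by linear_combination (-γ) * hab
      nth_rw 1 [hab']
      rw [map_add, map_mul GaussianInt.toComplex β]
      ring
    have e' := congrArg phi e
    rw [phi_add_lattice] at e'
    rcases Int.even_or_odd ((a * γ).re + (a * γ).im) with hev | hodd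
    · exact ⟨b * γ, by rw [e', hev.neg_one_zpow, one_mul]⟩
    · exact ⟨-(b * γ), by
        rw [e', hodd.neg_one_zpow, map_neg, neg_mul, phi_neg, neg_one_mul]⟩
  · rintro ⟨α, rfl⟩
    obtain ⟨-, Q, ε, -, -, -, h⟩ := h
    have hp : ¬ IsPole (GaussianInt.toComplex β * (GaussianInt.toComplex α * delta β)) := by
      rw [toComplex_mul_delta hβ.ne_zero]
      exact not_isPole_lattice _
    obtain ⟨hQ, k⟩ := h _ (hβ.not_isPole_delta α) hp
    rw [toComplex_mul_delta hβ.ne_zero, phi_lattice] at k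
    rw [IsRoot, eval_divisionPoly]
    have hI : Complex.I ^ ε ≠ 0 := pow_ne_zero _ Complex.I_ne_zero
    field_simp at k
    simpa using k.symm

/-- Differentiating the multiplication formula at the torsion point gives `β ψ(βz) Q(φ(z)⁴)` on one
side. This is nonzero, as `φ(βz) = 0` implies `ψ(βz)² = 1`; a multiple root would make the other
side vanish. -/
theorem IsMulNumerator.eval_derivative_ne_zero {β : GaussianInt} (hβ : IsOdd β)
    {P : GaussianInt[X]} (h : IsMulNumerator β P) (α : GaussianInt) :
    (derivative (divisionPoly P)).eval (phi (GaussianInt.toComplex α * delta β)) ≠ 0 := by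
  intro h0
  obtain ⟨-, Q, ε, -, -, -, h⟩ := h
  set z := GaussianInt.toComplex α * delta β with hz_def
  have hz : ¬ IsPole z := hβ.not_isPole_delta α
  have e : GaussianInt.toComplex β * z = varpi * GaussianInt.toComplex ((1 + gI) * α) :=
    toComplex_mul_delta hβ.ne_zero α
  have hp : ¬ IsPole (GaussianInt.toComplex β * z) := e ▸ not_isPole_lattice _
  have hzero : phi (GaussianInt.toComplex β * z) = 0 := e ▸ phi_lattice _
  have hd1 : HasDerivAt (fun w => phi (GaussianInt.toComplex β * w))
      (psi (GaussianInt.toComplex β * z) * (GaussianInt.toComplex β * 1)) z :=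
    HasDerivAt.comp z (hasDerivAt_phi hp) ((hasDerivAt_id z).const_mul _)
  have hd2 : DifferentiableAt ℂ (fun w => evalC Q (phi w ^ 4)) z :=
    (differentiable_evalC Q).differentiableAt.comp z ((differentiableAt_phi hz).pow 4)
  have hd3 : HasDerivAt (fun w => Complex.I ^ ε * (divisionPoly P).eval (phi w)) 0 z := by
    have := (HasDerivAt.comp z ((divisionPoly P).hasDerivAt (phi z)) (hasDerivAt_phi hz)).const_mul
      (Complex.I ^ ε)
    rwa [h0, zero_mul, mul_zero] at this
  have hev : (fun w => phi (GaussianInt.toComplex β * w) * evalC Q (phi w ^ 4)) =ᶠ[𝓝 z]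
      fun w => Complex.I ^ ε * (divisionPoly P).eval (phi w) := by
    have hc : ContinuousAt (fun w => GaussianInt.toComplex β * w) z := by fun_prop
    filter_upwards [eventually_not_isPole hz, hc.eventually (eventually_not_isPole hp)]
      with w hw hw'
    obtain ⟨hQ, k⟩ := h w hw hw'
    rw [eval_divisionPoly, k]
    field_simp
  have key := (hd3.congr_of_eventuallyEq hev).unique (hd1.mul hd2.hasDerivAt)
  rw [hzero, zero_mul, add_zero, mul_one] at key
  have hs := psi_sq hp
  rw [hzero] at hs
  have hψ : psi (GaussianInt.toComplex β * z) ≠ 0 := fun h1 => by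
    rw [h1] at hs
    norm_num at hs
  exact mul_ne_zero (mul_ne_zero hψ (toComplex_ne_zero hβ.ne_zero)) (h z hz hp).1 key.symm

theorem IsMulNumerator.eq_prod {β : GaussianInt} (hβ : IsOdd β) {P : GaussianInt[X]}
    (h : IsMulNumerator β P) :
    divisionPoly P = ∏ x ∈ (divisionPoly P).roots.toFinset, (X - C x) := by
  have hm := monic_divisionPoly h.1
  have hnodup : (divisionPoly P).roots.Nodup := by
    rw [Multiset.nodup_iff_count_le_one]
    intro x
    rw [count_roots]
    by_contra! hlt
    obtain ⟨h1, h2⟩ := (one_lt_rootMultiplicity_iff_isRoot hm.ne_zero).1 hlt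
    obtain ⟨α, rfl⟩ := (h.isRoot_iff hβ).1 h1
    exact h.eval_derivative_ne_zero hβ α h2
  have hs := (IsAlgClosed.splits (divisionPoly P)).eq_prod_roots_of_monic hm
  nth_rw 1 [hs]
  rw [Finset.prod, Multiset.toFinset_val, hnodup.dedup]

/-! ### Factorization into lemnatomic polynomials -/

theorem mk_rep (β : GaussianInt) (a : GaussianInt ⧸ Ideal.span {β}) :
    Ideal.Quotient.mk (Ideal.span {β}) (rep β a) = a :=
  Function.surjInv_eq _ a

theorem mk_eq_mk_iff {β a b : GaussianInt} :
    Ideal.Quotient.mk (Ideal.span {β}) a = Ideal.Quotient.mk (Ideal.span {β}) b ↔ β ∣ a - b := by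
  rw [Ideal.Quotient.eq, Ideal.mem_span_singleton]

theorem isCoprime_rep (β : GaussianInt) (u : (GaussianInt ⧸ Ideal.span {β})ˣ) :
    IsCoprime (rep β u) β := by
  have h := u.mul_inv
  rw [← mk_rep β u, ← mk_rep β (↑u⁻¹ : GaussianInt ⧸ Ideal.span {β}), ← map_mul, ← map_one
    (Ideal.Quotient.mk (Ideal.span {β})), mk_eq_mk_iff] at h
  obtain ⟨k, hk⟩ := h
  exact ⟨rep β (↑u⁻¹ : GaussianInt ⧸ Ideal.span {β}), -k, by linear_combination hk⟩

theorem toComplex_mul_delta_of_mul {γ c : GaussianInt} (h : γ * c ≠ 0) (α : GaussianInt) :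
    GaussianInt.toComplex α * delta γ = GaussianInt.toComplex (α * c) * delta (γ * c) := by
  have h1 := toComplex_ne_zero (left_ne_zero_of_mul h)
  have h2 := toComplex_ne_zero (right_ne_zero_of_mul h)
  rw [delta, delta, map_mul, map_mul]
  field_simp

/-- Associated normalized Gaussian integers are equal. -/
theorem IsNormalized.eq_of_associated {γ γ' : GaussianInt} (h : IsNormalized γ)
    (h' : IsNormalized γ') (ha : Associated γ γ') : γ = γ' := by
  obtain ⟨v, rfl⟩ := ha
  obtain ⟨-, k, hk⟩ := h
  obtain ⟨-, k', hk'⟩ := h'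
  obtain ⟨d, hd⟩ : ∃ d, (v : GaussianInt) - 1 = 2 * (1 + gI) * d :=
    ⟨k' - k - k * ((v : GaussianInt) - 1), by linear_combination hk' - (v : GaussianInt) * hk⟩
  have hn : Zsqrtd.norm (v : GaussianInt) = 1 :=
    (Zsqrtd.norm_eq_one_iff' (by norm_num) _).2 v.isUnit
  have hn2 := congrArg Zsqrtd.norm hd
  rw [Zsqrtd.norm_mul, show Zsqrtd.norm (2 * (1 + gI)) = 8 by decide] at hn2
  -- For a unit `v = a + bi`, the norm `2 - 2a` of `v - 1` is divisible by `8`, and `|a| ≤ 1` leaves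
  -- only `a = 1`.
  have hv : (v : GaussianInt) = 1 := by
    generalize Zsqrtd.norm d = m at hn2
    generalize (v : GaussianInt) = w at hn hn2
    obtain ⟨a, b⟩ := w
    simp only [Zsqrtd.norm_def, Zsqrtd.re_sub, Zsqrtd.im_sub, Zsqrtd.re_one, Zsqrtd.im_one]
      at hn hn2
    have hab : a ^ 2 + b ^ 2 = 1 := by linear_combination hn
    have ha1 : a ≤ 1 := by nlinarith [sq_nonneg b]
    have ha2 : -1 ≤ a := by nlinarith [sq_nonneg b]
    have ha : a = 1 := by
      have : 2 - 2 * a = 8 * m := by linear_combination hn2 - hn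
      omega
    subst ha
    have hb : b = 0 := by nlinarith
    subst hb
    rfl
  rw [hv, mul_one]

/-- The normalized divisors `γ` of `β`, each with a unit modulo `γ`. -/
abbrev TorsionIndex (β : GaussianInt) : Type :=
  Σ γ : {γ : GaussianInt // γ ∣ β ∧ IsNormalized γ}, (GaussianInt ⧸ Ideal.span {γ.1})ˣ

/-- The value of `φ` at the torsion point with a given index. -/
noncomputable def torsionValue (β : GaussianInt) (i : TorsionIndex β) : ℂ :=
  phi (GaussianInt.toComplex (rep i.1.1 i.2) * delta i.1.1)

/-- Over the common denominator `β`, equal values mean that the fractions `rep u / γ` and `rep u' /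
γ'` agree modulo `ℤ[i]`. Both are in lowest terms, so the denominators are associated, hence equal
by normalization. -/
theorem IsOdd.torsionValue_injective {β : GaussianInt} (hβ : IsOdd β) :
    Function.Injective (torsionValue β) := by
  rintro ⟨⟨γ, hγ, hn⟩, u⟩ ⟨⟨γ', hγ', hn'⟩, u'⟩ h
  obtain ⟨c, rfl⟩ := hγ
  obtain ⟨c', hc'⟩ := hγ'
  simp only [torsionValue] at h
  have h0 := hβ.ne_zero
  rw [toComplex_mul_delta_of_mul h0,
    toComplex_mul_delta_of_mul (γ := γ') (c := c') (by rwa [← hc']), ← hc'] at h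
  obtain ⟨k, hk⟩ := hβ.dvd_sub_of_phi_delta_eq h
  have key : rep γ u * γ' - rep γ' u' * γ = k * γ * γ' := by
    apply mul_left_cancel₀ h0
    linear_combination γ * γ' * hk - rep γ' u' * γ * hc'
  have h1 : γ ∣ γ' := (isCoprime_rep γ u).symm.dvd_of_dvd_mul_left
    ⟨k * γ' + rep γ' u', by linear_combination key⟩
  have h2 : γ' ∣ γ := (isCoprime_rep γ' u').symm.dvd_of_dvd_mul_left
    ⟨rep γ u - k * γ, by linear_combination -key⟩
  obtain rfl := hn.eq_of_associated hn' (associated_of_dvd_dvd h1 h2)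
  have hu : u = u' := by
    ext
    rw [← mk_rep γ u, ← mk_rep γ u', mk_eq_mk_iff]
    refine ⟨k, ?_⟩
    apply mul_left_cancel₀ hn.1.ne_zero
    linear_combination key
  rw [hu]

theorem IsOdd.exists_isNormalized_mul {γ : GaussianInt} (h : IsOdd γ) :
    ∃ v w : GaussianInt, v * w = 1 ∧ IsNormalized (γ * w) := by
  obtain ⟨ε, -, κ, hκ⟩ := h.exists_pow_gI
  have h1 : gI ^ ε * gI ^ (3 * ε) = 1 := by
    rw [← pow_add, show ε + 3 * ε = 4 * ε by ring, pow_mul, show gI ^ 4 = 1 by decide, one_pow]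
  refine ⟨gI ^ ε, gI ^ (3 * ε), h1, ?_, κ * gI ^ (3 * ε), ?_⟩
  · refine IsCoprime.mul_left h ?_
    exact isCoprime_one_left.of_isCoprime_of_dvd_left ⟨gI ^ ε, by rw [mul_comm, h1]⟩
  · linear_combination gI ^ (3 * ε) * hκ + h1

/-- Cancel the common factor `g` of `α` and `β`, then multiply numerator and denominator by the unit
`w` that normalizes the denominator. -/
theorem IsOdd.exists_torsionValue_eq {β : GaussianInt} (hβ : IsOdd β) (α : GaussianInt) :
    ∃ i, torsionValue β i = phi (GaussianInt.toComplex α * delta β) := by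
  obtain ⟨γ, a, g, hrel, rfl, rfl⟩ :=
    UniqueFactorizationMonoid.exists_reduced_factors β hβ.ne_zero α
  have hγ : IsOdd γ := hβ.of_dvd (dvd_mul_left _ _)
  obtain ⟨v, w, hvw, hn⟩ := hγ.exists_isNormalized_mul
  have e : g * γ = γ * w * (g * v) := by linear_combination (-g * γ) * hvw
  have e' : g * a = a * w * (g * v) := by linear_combination (-g * a) * hvw
  have hw : IsUnit w := IsUnit.of_mul_eq_one v (by rw [mul_comm, hvw])
  have hcop : IsCoprime (a * w) (γ * w) :=
    ((isCoprime_mul_unit_right hw _ _).2 hrel.symm.isCoprime)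
  have hunit : IsUnit (Ideal.Quotient.mk (Ideal.span {γ * w}) (a * w)) := by
    obtain ⟨r, s, hrs⟩ := hcop
    refine IsUnit.of_mul_eq_one (Ideal.Quotient.mk _ r) ?_
    rw [← map_mul, ← map_one (Ideal.Quotient.mk _), mk_eq_mk_iff]
    exact ⟨-s, by linear_combination hrs⟩
  refine ⟨⟨⟨γ * w, ⟨g * v, e⟩, hn⟩, hunit.unit⟩, ?_⟩
  change phi (GaussianInt.toComplex (rep (γ * w) hunit.unit) * delta (γ * w)) = _
  rw [e', e, ← toComplex_mul_delta_of_mul (e ▸ hβ.ne_zero)]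
  refine phi_delta_eq_of_dvd hn.1.ne_zero ?_
  rw [← mk_eq_mk_iff, mk_rep, IsUnit.unit_spec]

theorem IsMulNumerator.range_torsionValue {β : GaussianInt} (hβ : IsOdd β) {P : GaussianInt[X]}
    (h : IsMulNumerator β P) :
    range (torsionValue β) = (divisionPoly P).roots.toFinset := by
  ext x
  rw [Finset.mem_coe, Multiset.mem_toFinset, mem_roots (monic_divisionPoly h.1).ne_zero,
    h.isRoot_iff hβ]
  constructor
  · rintro ⟨⟨⟨γ, ⟨c, rfl⟩, hn⟩, u⟩, rfl⟩
    exact ⟨rep γ u * c, (congrArg phi (toComplex_mul_delta_of_mul hβ.ne_zero _)).symm⟩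
  · rintro ⟨α, rfl⟩
    exact hβ.exists_torsionValue_eq α

/-- The index set injects into the roots of a nonzero polynomial; this also yields finiteness of the
set of normalized divisors. -/
theorem IsOdd.finite_torsionIndex {β : GaussianInt} (hβ : IsOdd β) : Finite (TorsionIndex β) := by
  obtain ⟨P, hP⟩ := hβ.exists_isMulNumerator
  have hfin : (range (torsionValue β)).Finite := by
    rw [hP.range_torsionValue hβ]
    exact Finset.finite_toSet _
  have := hfin.to_subtype
  exact Finite.of_injective_finite_range hβ.torsionValue_injective

theorem IsOdd.finite_normalized_divisors {β : GaussianInt} (hβ : IsOdd β) :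
    {γ : GaussianInt | γ ∣ β ∧ IsNormalized γ}.Finite := by
  have := hβ.finite_torsionIndex
  have : Finite {γ : GaussianInt // γ ∣ β ∧ IsNormalized γ} :=
    Finite.of_injective (fun γ => (⟨γ, 1⟩ : TorsionIndex β)) fun _ _ h => congrArg Sigma.fst h
  exact @Set.toFinite _ _ this

theorem IsMulNumerator.divisionPoly_eq {β : GaussianInt} (hβ : IsOdd β) {P : GaussianInt[X]}
    (h : IsMulNumerator β P) :
    divisionPoly P = ∏ᶠ (γ : GaussianInt) (_ : γ ∣ β ∧ IsNormalized γ), lemnatomic γ := by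
  classical
  have hfin := hβ.finite_torsionIndex
  have hfin1 : Finite {γ : GaussianInt // γ ∣ β ∧ IsNormalized γ} := hβ.finite_normalized_divisors
  have hfin2 : ∀ γ : {γ : GaussianInt // γ ∣ β ∧ IsNormalized γ},
      Finite (GaussianInt ⧸ Ideal.span {γ.1})ˣ := fun γ =>
    Finite.of_injective (fun u => (⟨γ, u⟩ : TorsionIndex β)) fun _ _ h =>
      eq_of_heq (Sigma.mk.inj h).2
  have := Fintype.ofFinite {γ : GaussianInt // γ ∣ β ∧ IsNormalized γ}
  have := fun γ : {γ : GaussianInt // γ ∣ β ∧ IsNormalized γ} =>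
    Fintype.ofFinite (GaussianInt ⧸ Ideal.span {γ.1})ˣ
  have himage : (divisionPoly P).roots.toFinset = Finset.univ.image (torsionValue β) := by
    apply Finset.coe_injective
    rw [← h.range_torsionValue hβ]
    simp
  rw [h.eq_prod hβ, himage, Finset.prod_image hβ.torsionValue_injective.injOn, Fintype.prod_sigma,
    ← finprod_subtype_eq_finprod_cond, finprod_eq_prod_of_fintype]
  refine Finset.prod_congr rfl fun γ _ => ?_
  rw [lemnatomic, finprod_eq_prod_of_fintype]
  rfl

end Lemniscate

theorem proposition5p3 (β : GaussianInt) (hβ : Lemniscate.IsOdd β) :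
    {γ : GaussianInt | γ ∣ β ∧ Lemniscate.IsNormalized γ}.Finite ∧
    (∃! P : Polynomial GaussianInt, Lemniscate.IsMulNumerator β P) ∧
    ∀ P : Polynomial GaussianInt, Lemniscate.IsMulNumerator β P →
      Lemniscate.divisionPoly P =
        ∏ᶠ (γ : GaussianInt) (_ : γ ∣ β ∧ Lemniscate.IsNormalized γ),
          Lemniscate.lemnatomic γ := by
  refine ⟨hβ.finite_normalized_divisors, ?_, fun P hP => hP.divisionPoly_eq hβ⟩
  obtain ⟨P, hP⟩ := hβ.exists_isMulNumerator
  exact ⟨P, hP, fun P' hP' => hP'.unique hP⟩
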